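/- **Setting.** Let $k,T\in\mathbb N$, $\sigma\ge 0$. A graph-triggered bandit consists of reward distributions $\nu_{i,n}$ on $\mathbb R$ ($i\in[k]$, $n\ge 1$) with means $\mu_i(n)$, and of a connectivity matrix $\mathbf G\in\{0,1\}^{k\times k}$. In round $t$ an arm $I_t$ is chosen from the past history $(I_s,X_s)_{s<t}$ (possibly with randomization), and a reward $X_t\sim\nu_{I_t,\widetilde N_{I_t,t}}$ is observed, where $\widetilde N_{i,t}=\sum_{s\le t}\mathbf G_{I_s,i}$ is the number of triggers of arm $i$. The bandit is a *$\sigma^2$-subgaussian rising* bandit with horizon $T$ if, with $\gamma_i(n)=\mu_i(n+1)-\mu_i(n)$: $\mu_i(n)\in[0,1]$ and $\nu_{i,n}$ (centered) is $\sigma^2$-subgaussian for all $i$ and $n\in[T]$, and $n\mapsto\mu_i(n)$ is nondecreasing and concave on $[T]$ ($\gamma_i\ge0$ and $\gamma_i$ nonincreasing). $\mathbf G$ is *block-diagonal* with set of cliques $\mathcal C$ if $\mathcal C$ is a partition of $[k]$ and $\mathbf G_{i,j}=1$ exactly when $i,j$ lie in the same $C\in\mathcal C$; let $\bar k_1$ be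 the number of cliques with exactly one arm. For $M\in\mathbb N$, $q\in[0,1]$ let $\Upsilon(M,q)=\sum_{t=1}^{M-1}\max_{i\in[k]}\gamma_i(t)^q$ (with $0^0=1$). The expected policy regret of a policy $\pi$ is $R_T(\pi)=\sup_{\pi'}J_T(\pi')-J_T(\pi)$, where $J_T(\pi)=\mathbb E\big[\sum_{t\le T}\mu_{I_t}(\widetilde N_{I_t,t})\big]$. **Algorithm.** R-$\square$-UCB with inputs $\sigma$, $\epsilon\in(0,1/2)$ and $(\delta_t)_t$ pulls in each round $t$ an arm maximizing the index $B_i(t)$ (ties broken arbitrarily). With $N=N_{i,t-1}$ the number of pulls of arm $i$ before round $t$, $h=\lfloor\epsilon N\rfloor$, and $X_{i}^{(l)}$ the reward of the $l$-th pull of arm $i$: $B_i(t)=+\infty$ if $h=0$, and otherwise $$B_i(t)=\frac1h\sum_{l=N-h+1}^{N}\Big(X_i^{(l)}+(t-l)\frac{X_i^{(l)}-X_i^{(l-h)}}{h}\Big)+\sigma\,(t-N+h-1)\sqrt{\frac{10\log(1/\delta_t)}{h^3}} .$$ It uses neither $\mathbf G$, nor the distributions $\nu$, nor the horizon $T$.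 **Theorem.** There is an exponent $p\in\mathbb N$, and for every $\epsilon\in(0,1/2)$ and $\alpha>2$ there is a constant $K$ depending only on $\epsilon$ and $\alpha$, such that for all $k$ and $\sigma$, for every R-$\square$-UCB policy $\pi$ with inputs $\sigma$, $\epsilon$ and $\delta_t=t^{-\alpha}$, for every horizon $T\ge1$ and every $\sigma^2$-subgaussian rising graph-triggered bandit with horizon $T$ and block-diagonal $\mathbf G$ with set of cliques $\mathcal C$, $$R_T(\pi)\le K\,(1+\log T)^p\,\inf_{q\in[0,1]}\Big\{k+k(\sigma T)^{\frac23}+\bar k_1T^q\,\Upsilon\Big(\Big\lceil\tfrac{T}{\bar k_1}\Big\rceil,q\Big)+T^{\frac{2q}{1+q}}\sum_{C\in\mathcal C:\,|C|>1}|C|\,\Upsilon\Big(\Big\lceil\tfrac{T}{|C|}\Big\rceil,q\Big)^{\frac1{1+q}}\Big\},$$ where the term with $\bar k_1$ is $0$ if $\bar k_1=0$. -/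

import Mathlib

open MeasureTheory ProbabilityTheory
open scoped NNReal

noncomputable section

namespace GTB

/-- The history of the first `t` rounds of a `k`-armed bandit: the pairs (pulled arm, observed
reward). Round number `τ ∈ {1, …, t}` has index `τ - 1` in `Fin t`. -/
abbrev History (k t : ℕ) : Type := Fin t → Fin k × ℝ

/-- A (possibly randomized) policy: the law of the next arm given the history so far.
It sees nothing but the history; a deterministic policy is the case of Dirac kernels. -/
structure Policy (k : ℕ) where
  /-- `next t` is the law of the arm pulled in round `t + 1`. -/
  next : (t : ℕ) → Kernel (History k t) (Fin k)
  isMarkov : ∀ t, IsMarkovKernel (next t)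

attribute [instance] Policy.isMarkov

/-! ### The environment -/

/-- Number of triggers of arm `i` at the end of the round with index `s`:
`∑_{τ ≤ s} G_{I_τ, i}`. -/
def triggers {k t : ℕ} (G : Matrix (Fin k) (Fin k) ℕ) (H : History k t) (s : Fin t)
    (i : Fin k) : ℕ :=
  ∑ τ ∈ Finset.Iic s, G (H τ).1 i

/-- The law of the reward in round `t + 1`, given the history `H` of the first `t` rounds and
the pulled arm `i`: it is `ν i n`, where `n` is the number of triggers of `i`, the pull taking
place included. -/
def rewardKernel {k : ℕ} (ν : Fin k → ℕ → Measure ℝ) (G : Matrix (Fin k) (Fin k) ℕ) (t : ℕ) :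
    Kernel (History k t × Fin k) ℝ where
  toFun p := ν p.2 (∑ τ, G (p.1 τ).1 p.2 + G p.2 p.2)
  measurable' := by
    have h1 : Measurable (fun p : History k t × Fin k => ((fun τ => (p.1 τ).1), p.2)) := by
      fun_prop
    have h2 : Measurable (fun a : (Fin t → Fin k) × Fin k =>
        ν a.2 (∑ τ, G (a.1 τ) a.2 + G a.2 a.2)) := measurable_of_countable _
    exact h2.comp h1

/-- The law of the history of the first `t` rounds when policy `π` interacts with the
graph-triggered bandit `(ν, G)`. -/
def historyLaw {k : ℕ} (ν : Fin k → ℕ → Measure ℝ) (G : Matrix (Fin k) (Fin k) ℕ)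
    (π : Policy k) : (t : ℕ) → Measure (History k t)
  | 0 => Measure.dirac Fin.elim0
  | t + 1 => (historyLaw ν G π t ⊗ₘ (π.next t ⊗ₖ rewardKernel ν G t)).map
      (fun p => Fin.snoc (α := fun _ => Fin k × ℝ) p.1 p.2)

/-- The expected reward `μ_i(n)`. -/
def mean {k : ℕ} (ν : Fin k → ℕ → Measure ℝ) (i : Fin k) (n : ℕ) : ℝ := ∫ x, x ∂(ν i n)

/-- The increment `γ_i(n) = μ_i(n + 1) - μ_i(n)`. -/
def increment {k : ℕ} (ν : Fin k → ℕ → Measure ℝ) (i : Fin k) (n : ℕ) : ℝ :=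
  mean ν i (n + 1) - mean ν i n

/-- Rising bandit with horizon `T`: expected rewards in `[0, 1]`, noise `σ ^ 2`-subgaussian,
expected rewards nondecreasing and concave in the number of triggers `n ∈ {1, …, T}`. -/
structure IsRising {k : ℕ} (ν : Fin k → ℕ → Measure ℝ) (T : ℕ) (σ : ℝ≥0) : Prop where
  mean_mem : ∀ i n, 1 ≤ n → n ≤ T → mean ν i n ∈ Set.Icc (0 : ℝ) 1
  subgaussian : ∀ i n, 1 ≤ n → n ≤ T →
    HasSubgaussianMGF (fun x => x - mean ν i n) (σ ^ 2) (ν i n)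
  nondecreasing : ∀ i n, 1 ≤ n → n + 1 ≤ T → 0 ≤ increment ν i n
  concave : ∀ i n, 1 ≤ n → n + 2 ≤ T → increment ν i (n + 1) ≤ increment ν i n

/-- The total increment `Υ(M, q) = ∑_{t = 1}^{M - 1} max_i γ_i(t) ^ q`. -/
def totalIncrement {k : ℕ} (ν : Fin k → ℕ → Measure ℝ) (M : ℕ) (q : ℝ) : ℝ :=
  ∑ t ∈ Finset.Icc 1 (M - 1), ⨆ i : Fin k, increment ν i t ^ q

/-- `G` is the block-diagonal connectivity matrix (cluster graph) whose cliques are the parts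
of `𝒞`: entry `1` if both arms lie in the same clique, `0` otherwise. -/
def IsBlockDiagonal {k : ℕ} (G : Matrix (Fin k) (Fin k) ℕ)
    (𝒞 : Finpartition (Finset.univ : Finset (Fin k))) : Prop :=
  ∀ i j, ((∃ C ∈ 𝒞.parts, i ∈ C ∧ j ∈ C) → G i j = 1) ∧
    ((¬ ∃ C ∈ 𝒞.parts, i ∈ C ∧ j ∈ C) → G i j = 0)

/-! ### Regret -/

/-- Expected cumulative reward `J(π)` over `T` rounds. -/
def expectedReward {k : ℕ} (ν : Fin k → ℕ → Measure ℝ) (G : Matrix (Fin k) (Fin k) ℕ) (T : ℕ)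
    (π : Policy k) : ℝ :=
  ∫ H, (∑ s : Fin T, mean ν (H s).1 (triggers G H s (H s).1)) ∂(historyLaw ν G π T)

/-- Expected policy regret: the best expected cumulative reward over all policies minus that
of `π`. -/
def regret {k : ℕ} (ν : Fin k → ℕ → Measure ℝ) (G : Matrix (Fin k) (Fin k) ℕ) (T : ℕ)
    (π : Policy k) : ℝ :=
  (⨆ π' : Policy k, expectedReward ν G T π') - expectedReward ν G T π

/-! ### The algorithm -/

/-- Number of pulls of arm `i` in the history. -/
def pulls {k t : ℕ} (H : History k t) (i : Fin k) : ℕ :=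
  (Finset.univ.filter fun τ => (H τ).1 = i).card

/-- The reward observed at the `l`-th pull of arm `i`, for `1 ≤ l ≤ pulls H i` (exactly one
summand is selected). -/
def obs {k t : ℕ} (H : History k t) (i : Fin k) (l : ℕ) : ℝ :=
  ∑ s : Fin t, if (H s).1 = i ∧ ((Finset.Iic s).filter fun τ => (H τ).1 = i).card = l
    then (H s).2 else 0

/-- The estimator of the reward of arm `i` in round `t + 1` with window `h ≥ 1`. -/
def estimator {k t : ℕ} (H : History k t) (i : Fin k) (h : ℕ) : ℝ :=
  (1 / (h : ℝ)) * ∑ l ∈ Finset.Icc (pulls H i - h + 1) (pulls H i),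
    (obs H i l + (((t + 1 : ℕ) : ℝ) - l) * ((obs H i l - obs H i (l - h)) / h))

/-- The exploration bonus of arm `i` in round `t + 1` with window `h ≥ 1` and confidence `δ`. -/
def bonus {k t : ℕ} (σ : ℝ≥0) (H : History k t) (i : Fin k) (h : ℕ) (δ : ℝ) : ℝ :=
  σ * (((t + 1 : ℕ) : ℝ) - pulls H i + h - 1) * Real.sqrt (10 * Real.log (1 / δ) / (h : ℝ) ^ 3)

/-- The upper confidence index of arm `i` in round `t + 1`, with window `⌊ε N_{i,t}⌋`, where
`N_{i,t}` is the number of pulls in the first `t` rounds. It is `+∞` if the window is empty. -/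
def index {k t : ℕ} (σ : ℝ≥0) (ε : ℝ) (δ : ℕ → ℝ) (H : History k t) (i : Fin k) : EReal :=
  if ⌊ε * pulls H i⌋₊ = 0 then ⊤
  else ((estimator H i ⌊ε * pulls H i⌋₊ + bonus σ H i ⌊ε * pulls H i⌋₊ (δ (t + 1)) : ℝ) : EReal)

/-- `π` is the R-□-UCB algorithm with inputs `σ`, `ε`, `δ`: in every round it only pulls arms
of maximal index (ties are broken in any way). -/
def IsRBoxUCB {k : ℕ} (σ : ℝ≥0) (ε : ℝ) (δ : ℕ → ℝ) (π : Policy k) : Prop :=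
  ∀ (t : ℕ) (H : History k t) (i : Fin k), π.next t H {i} ≠ 0 →
    ∀ j, index σ ε δ H j ≤ index σ ε δ H i

/-! ### The bound -/

/-- Number of cliques containing a single arm. -/
def numSingletons {k : ℕ} (𝒞 : Finpartition (Finset.univ : Finset (Fin k))) : ℕ :=
  (𝒞.parts.filter fun C => C.card = 1).card

/-- The sum of the rested and of the restless bias contribution, for a given `q`. -/
def biasTerm {k : ℕ} (ν : Fin k → ℕ → Measure ℝ)
    (𝒞 : Finpartition (Finset.univ : Finset (Fin k))) (T : ℕ) (q : ℝ) : ℝ :=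
  (numSingletons 𝒞 : ℝ) * (T : ℝ) ^ q *
      totalIncrement ν ⌈(T : ℝ) / (numSingletons 𝒞 : ℝ)⌉₊ q +
    (T : ℝ) ^ (2 * q / (1 + q)) * ∑ C ∈ 𝒞.parts.filter (fun C => 1 < C.card),
      (C.card : ℝ) * totalIncrement ν ⌈(T : ℝ) / (C.card : ℝ)⌉₊ q ^ (1 / (1 + q))

end GTB

end

/-!
The regret is compared, round by round, with the largest value `max_i μ_i(t)` that any arm could
have in round `t`; no policy earns more (`expectedReward_le`), as an arm is triggered at most once
per round.

Free of noise, the estimator of an arm is an average of linear extrapolations through its rewards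
at two pulls, the `(l - h)`-th and the `l`-th. These are at least `h` triggers apart, and the later
one happens at a number `n ≥ l` of triggers, so that `t - n ≤ t - l`. By concavity the extrapolation
overestimates `μ_i(t)`, whatever the cliques are (`mean_le_extrapolate_meanObs`). The
noise of the estimator is, for a fixed number `N` of pulls, a weighted sum of martingale differences
with deterministic weights, hence subgaussian by induction on the rounds (`lintegral_exp_noise_le`);
the bonus is calibrated so that it is exceeded with probability at most `2 t ^ (-α)`
(`measure_noise_gt_le`), and a union bound over `t`, the arms and `N < t` costs `O(k)` in total since
`α > 2`. Apart from these deviations, a round in which arm `i` is pulled after `N` earlier pulls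
loses at most the sum of twice the bonus and the bias of the estimator, both truncated at `1`, or
`1` if the window is still empty, which happens for `O(1 / ε)` pulls of each arm (`loss_le`).

It remains to sum over the pulls, with `min 1 x ≤ x ^ r` for suitable `r ∈ [0, 1]`.
* Bonus: `r = 2 / 3` turns `σ T N ^ (-3 / 2)` into `(σ T) ^ (2 / 3) / N`, a harmonic sum. This and
  the logarithm inside the bonus are the only sources of `log T`.
* Bias of a rested arm: it is at most `T γ_i((1 - 2ε)N)`, and `r = q` gives `T ^ q γ_i ^ q`
  (`sum_rested_bias_le`).
* Bias in a larger clique: `T` triggers may fall into a window of `εN` pulls, so the bound becomes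
  `T ^ 2 γ_i((1 - 2ε)N) / (εN)`. The first `x` pulls of each arm are charged `1`, and `r = q` bounds
  the others by `T ^ (2 q) x ^ (-q) γ_i ^ q`; the two parts balance for
  `x = T ^ (2 q / (1 + q)) Υ ^ (1 / (1 + q))` (`exists_balance`, `sum_restless_bias_le`).

In both cases the pulls of a group of `m` arms are at most `T` in total and the increments decrease,
so that the sum over the group is at most a constant times `m Υ(⌈T / m⌉, q)` (`sum_sum_Icc_le`),
except if `T ≤ m`, when charging `1` to every pull costs at most `m`.
-/

namespace GTB

/-! ### Sums of antitone sequences -/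

theorem sum_Icc_le_add_mul {g : ℕ → ℝ} (h0 : ∀ n, 0 ≤ g n)
    (hg : ∀ a b, 1 ≤ a → a ≤ b → g b ≤ g a) {a : ℕ} (ha : 1 ≤ a) (N : ℕ) :
    ∑ n ∈ Finset.Icc 1 N, g n ≤ ∑ n ∈ Finset.Icc 1 a, g n + N * g a := by
  have h1 : ∑ n ∈ Finset.Icc 1 N, g n
      ≤ ∑ n ∈ Finset.Icc 1 N, ((if n ≤ a then g n else 0) + g a) := by
    refine Finset.sum_le_sum fun n _ => ?_
    split_ifs with h
    · linarith [h0 a]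
    · linarith [hg a n ha (by omega)]
  refine h1.trans ?_
  rw [Finset.sum_add_distrib, ← Finset.sum_filter]
  simp only [Finset.sum_const, Nat.card_Icc, nsmul_eq_mul, Nat.add_sub_cancel]
  gcongr
  · exact fun _ _ _ => h0 _
  · intro n hn
    simp only [Finset.mem_filter, Finset.mem_Icc] at hn ⊢
    omega

/-- A discrete Jensen inequality, up to the factor `3`: partial sums of an antitone sequence up to
lengths `N i` of average at most `M` are controlled by the partial sum up to `M - 1`. For `M = 1`
it would fail, the right-hand side being zero. -/
theorem sum_sum_Icc_le {ι : Type*} {g : ℕ → ℝ} (h0 : ∀ n, 0 ≤ g n)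
    (hg : ∀ a b, 1 ≤ a → a ≤ b → g b ≤ g a) (s : Finset ι) (N : ι → ℕ) {M : ℕ} (hM : 2 ≤ M)
    (hN : ∑ i ∈ s, N i ≤ s.card * M) :
    ∑ i ∈ s, ∑ n ∈ Finset.Icc 1 (N i), g n
      ≤ 3 * s.card * ∑ n ∈ Finset.Icc 1 (M - 1), g n := by
  have hlow : ((M - 1 : ℕ) : ℝ) * g (M - 1) ≤ ∑ n ∈ Finset.Icc 1 (M - 1), g n := by
    calc ((M - 1 : ℕ) : ℝ) * g (M - 1) = ∑ n ∈ Finset.Icc 1 (M - 1), g (M - 1) := by simp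
      _ ≤ _ := Finset.sum_le_sum fun n hn => by
        rw [Finset.mem_Icc] at hn
        exact hg _ _ hn.1 hn.2
  have hM' : (M : ℝ) ≤ 2 * ((M - 1 : ℕ) : ℝ) := by
    exact_mod_cast (by omega : M ≤ 2 * (M - 1))
  have hN' : (∑ i ∈ s, (N i : ℝ)) ≤ s.card * M := by exact_mod_cast hN
  calc ∑ i ∈ s, ∑ n ∈ Finset.Icc 1 (N i), g n
      ≤ ∑ i ∈ s, (∑ n ∈ Finset.Icc 1 (M - 1), g n + N i * g (M - 1)) :=
        Finset.sum_le_sum fun i _ => sum_Icc_le_add_mul h0 hg (by omega) _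
    _ = s.card * ∑ n ∈ Finset.Icc 1 (M - 1), g n + (∑ i ∈ s, (N i : ℝ)) * g (M - 1) := by
        rw [Finset.sum_add_distrib, Finset.sum_mul]; simp
    _ ≤ s.card * ∑ n ∈ Finset.Icc 1 (M - 1), g n + (s.card * M) * g (M - 1) := by
        gcongr; exact h0 _
    _ ≤ s.card * ∑ n ∈ Finset.Icc 1 (M - 1), g n
          + s.card * (2 * (((M - 1 : ℕ) : ℝ) * g (M - 1))) := by
        have := mul_le_mul_of_nonneg_right hM' (h0 (M - 1))
        have := mul_le_mul_of_nonneg_left this (Nat.cast_nonneg (α := ℝ) s.card)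
        nlinarith
    _ ≤ s.card * ∑ n ∈ Finset.Icc 1 (M - 1), g n
          + s.card * (2 * ∑ n ∈ Finset.Icc 1 (M - 1), g n) := by gcongr
    _ = _ := by ring

theorem sum_range_div_le {g : ℕ → ℝ} (h0 : ∀ n, 0 ≤ g n) {D : ℕ} (hD : 1 ≤ D) (L : ℕ) :
    ∑ n ∈ Finset.range L, g (n / D + 1) ≤ D * ∑ n ∈ Finset.Icc 1 L, g n := by
  rw [← Finset.sum_fiberwise_of_maps_to (s := Finset.range L) (t := Finset.Icc 1 L)
    (g := fun n => n / D + 1), Finset.mul_sum]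
  · refine Finset.sum_le_sum fun m hm => ?_
    rw [Finset.sum_congr rfl (g := fun _ => g m)
      (fun n hn => by rw [(Finset.mem_filter.1 hn).2])]
    rw [Finset.sum_const, nsmul_eq_mul]
    refine mul_le_mul_of_nonneg_right ?_ (h0 m)
    have : (Finset.range L).filter (fun n => n / D + 1 = m)
        ⊆ Finset.Ico ((m - 1) * D) ((m - 1) * D + D) := by
      intro n hn
      simp only [Finset.mem_filter, Finset.mem_range, Finset.mem_Ico] at hn ⊢
      have h2 := Nat.div_add_mod n D
      have h3 := Nat.mod_lt n hD
      have h4 : m - 1 = n / D := by rw [← hn.2]; rfl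
      rw [h4, mul_comm]
      exact ⟨Nat.mul_div_le n D, by linarith⟩
    have := Finset.card_le_card this
    simp only [Nat.card_Ico, Nat.add_sub_cancel_left] at this
    exact_mod_cast this
  · intro n hn
    simp only [Finset.mem_range, Finset.mem_Icc] at hn ⊢
    have := Nat.div_le_self n D
    exact ⟨Nat.le_add_left _ _, by linarith⟩

/-- The index `N - 2⌊εN⌋ + 1` of the oldest pull that enters the estimator after `N` pulls. -/
noncomputable def oldest (ε : ℝ) (N : ℕ) : ℕ := N - 2 * ⌊ε * N⌋₊ + 1

theorem two_mul_floor_le {ε : ℝ} (hε : 0 < ε) (hε' : ε < 1 / 2) (N : ℕ) :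
    2 * ⌊ε * N⌋₊ ≤ N := by
  have h1 : ((⌊ε * N⌋₊ : ℕ) : ℝ) ≤ ε * N := Nat.floor_le (by positivity)
  have h2 : ((2 * ⌊ε * N⌋₊ : ℕ) : ℝ) ≤ N := by
    push_cast
    nlinarith [Nat.cast_nonneg (α := ℝ) N]
  exact_mod_cast h2

theorem div_le_oldest {ε : ℝ} (hε : 0 < ε) (hε' : ε < 1 / 2) (N : ℕ) :
    N / ⌈1 / (1 - 2 * ε)⌉₊ + 1 ≤ oldest ε N := by
  have hpos : 0 < 1 - 2 * ε := by linarith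
  have h1 : ((⌊ε * N⌋₊ : ℕ) : ℝ) ≤ ε * N := Nat.floor_le (by positivity)
  have h2 := two_mul_floor_le hε hε' N
  have h3 : ((N / ⌈1 / (1 - 2 * ε)⌉₊ : ℕ) : ℝ) ≤ (N - 2 * ⌊ε * N⌋₊ : ℕ) := by
    refine Nat.cast_div_le.trans ?_
    rw [Nat.cast_sub h2]
    push_cast
    have h4 : (1 / (1 - 2 * ε)) ≤ (⌈1 / (1 - 2 * ε)⌉₊ : ℝ) := Nat.le_ceil _
    have h5 : (N : ℝ) / (⌈1 / (1 - 2 * ε)⌉₊ : ℝ) ≤ N / (1 / (1 - 2 * ε)) := by gcongr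
    refine h5.trans ?_
    rw [div_div_eq_mul_div, div_one]
    linarith
  have := (Nat.cast_le (α := ℝ)).1 h3
  unfold oldest
  omega

/-- The slopes met by the estimator are those of an index at least `(1 - 2ε)N`, so summing them
over the pulls costs a factor depending on `ε` alone. -/
theorem sum_oldest_le {ε : ℝ} (hε : 0 < ε) (hε' : ε < 1 / 2) {g : ℕ → ℝ} (h0 : ∀ n, 0 ≤ g n)
    (hg : ∀ a b, 1 ≤ a → a ≤ b → g b ≤ g a) (L : ℕ) :
    ∑ n ∈ Finset.range L, g (oldest ε n)
      ≤ (⌈1 / (1 - 2 * ε)⌉₊ : ℝ) * ∑ n ∈ Finset.Icc 1 L, g n := by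
  refine le_trans (Finset.sum_le_sum fun n _ => hg _ _ (Nat.le_add_left _ _) (div_le_oldest hε hε' n)) ?_
  refine sum_range_div_le h0 ?_ L
  exact Nat.one_le_ceil_iff.2 (by have : 0 < 1 - 2 * ε := by linarith
                                  positivity)

/-! ### Bounds per pull -/

theorem min_one_le_rpow {x q : ℝ} (hx : 0 ≤ x) (hq : 0 ≤ q) (hq' : q ≤ 1) :
    min 1 x ≤ x ^ q := by
  rcases le_total 1 x with h | h
  · exact (min_le_left _ _).trans (Real.one_le_rpow h hq)
  · rcases hx.eq_or_lt with rfl | hx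
    · exact (min_le_right _ _).trans (Real.rpow_nonneg le_rfl _)
    · refine (min_le_right _ _).trans ?_
      simpa using Real.rpow_le_rpow_of_exponent_ge hx h hq'

theorem half_mul_le_floor {ε : ℝ} (N : ℕ) (h : ⌊ε * N⌋₊ ≠ 0) :
    ε * N / 2 ≤ (⌊ε * N⌋₊ : ℝ) := by
  have h1 := Nat.lt_floor_add_one (ε * N)
  have h2 : (1 : ℝ) ≤ (⌊ε * N⌋₊ : ℝ) := by exact_mod_cast Nat.one_le_iff_ne_zero.2 h
  linarith

theorem one_le_of_floor_ne_zero {ε : ℝ} {N : ℕ} (h : ⌊ε * N⌋₊ ≠ 0) : 1 ≤ N := by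
  by_contra hN
  obtain rfl : N = 0 := by omega
  simp at h

theorem oldest_lt {ε : ℝ} (hε : 0 < ε) (hε' : ε < 1 / 2) {N : ℕ} (h : ⌊ε * N⌋₊ ≠ 0) :
    oldest ε N < N := by
  have h2 := two_mul_floor_le hε hε' N
  unfold oldest
  omega

/-- The two-thirds power makes the exploration bonus summable up to a logarithm. -/
theorem min_one_bonus_le {ε α y ℓ : ℝ} (hε : 0 < ε) (hα : 0 ≤ α) (hy : 0 ≤ y) (hℓ : 0 ≤ ℓ) {N : ℕ}
    (h : ⌊ε * N⌋₊ ≠ 0) :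
    min 1 (2 * (y * Real.sqrt (10 * (α * ℓ) / (⌊ε * N⌋₊ : ℝ) ^ 3)))
      ≤ 4 / ε * (1 + 10 * α) * (1 + ℓ) * y ^ (2 / 3 : ℝ) * (1 / (N : ℝ)) := by
  have hN := one_le_of_floor_ne_zero h
  have hN' : (0 : ℝ) < N := by exact_mod_cast hN
  have hh := half_mul_le_floor N h
  set w : ℝ := (⌊ε * N⌋₊ : ℝ) with hw
  have hw0 : 0 < w := lt_of_lt_of_le (by positivity) hh
  refine (min_one_le_rpow (q := 2 / 3) (by positivity) (by norm_num) (by norm_num)).trans ?_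
  have hL : 0 ≤ 10 * (α * ℓ) := by positivity
  have e1 : Real.sqrt (10 * (α * ℓ) / w ^ 3) ^ (2 / 3 : ℝ) = (10 * (α * ℓ)) ^ (1 / 3 : ℝ) / w := by
    rw [Real.sqrt_eq_rpow, ← Real.rpow_mul (by positivity),
      Real.div_rpow hL (by positivity), ← Real.rpow_natCast, ← Real.rpow_mul hw0.le]
    norm_num
  have e2 : (2 : ℝ) ^ (2 / 3 : ℝ) ≤ 2 := by
    simpa using Real.rpow_le_rpow_of_exponent_le (x := 2) (y := 2 / 3) (z := 1) (by norm_num)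
      (by norm_num)
  have e3 : (10 * (α * ℓ)) ^ (1 / 3 : ℝ) ≤ (1 + 10 * α) * (1 + ℓ) := by
    have : (10 * (α * ℓ)) ^ (1 / 3 : ℝ) ≤ (1 + 10 * (α * ℓ)) ^ (1 : ℝ) := by
      refine (Real.rpow_le_rpow hL (by linarith : _ ≤ 1 + 10 * (α * ℓ)) (by norm_num)).trans ?_
      exact Real.rpow_le_rpow_of_exponent_le (by linarith) (by norm_num)
    rw [Real.rpow_one] at this
    nlinarith [mul_nonneg hα hℓ]
  have e4 : 1 / w ≤ 2 / ε * (1 / N) := by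
    rw [div_mul_div_comm, mul_one, div_le_div_iff₀ hw0 (by positivity)]
    linarith
  rw [Real.mul_rpow (by norm_num) (by positivity), Real.mul_rpow hy (by positivity), e1]
  calc (2 : ℝ) ^ (2 / 3 : ℝ) * (y ^ (2 / 3 : ℝ) * ((10 * (α * ℓ)) ^ (1 / 3 : ℝ) / w))
      = (2 : ℝ) ^ (2 / 3 : ℝ) * y ^ (2 / 3 : ℝ) * ((10 * (α * ℓ)) ^ (1 / 3 : ℝ) * (1 / w)) := by ring
    _ ≤ 2 * y ^ (2 / 3 : ℝ) * (((1 + 10 * α) * (1 + ℓ)) * (2 / ε * (1 / N))) := by gcongr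
    _ = _ := by ring

/-- Total contribution of the bias of the arms in `s` when they are rested. -/
theorem sum_rested_bias_le {ι : Type*} {ε : ℝ} (hε : 0 < ε) (hε' : ε < 1 / 2) {T : ℕ} {q : ℝ}
    (hq : 0 ≤ q) (hq' : q ≤ 1) {γ : ι → ℕ → ℝ} {g : ℕ → ℝ} (h0 : ∀ n, 0 ≤ g n)
    (hg : ∀ a b, 1 ≤ a → a ≤ b → g b ≤ g a)
    (hγ : ∀ i n, 1 ≤ n → n + 1 ≤ T → 0 ≤ γ i n ∧ γ i n ^ q ≤ g n)
    (s : Finset ι) (N : ι → ℕ) {M : ℕ} (hN : ∑ i ∈ s, N i ≤ T) (hM : T ≤ s.card * M) :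
    ∑ i ∈ s, ∑ n ∈ Finset.range (N i),
        (if ⌊ε * n⌋₊ = 0 then 0 else min 1 (T * γ i (oldest ε n)))
      ≤ s.card + 3 * ⌈1 / (1 - 2 * ε)⌉₊ *
          (s.card * (T : ℝ) ^ q * ∑ n ∈ Finset.Icc 1 (M - 1), g n) := by
  have hΥ : 0 ≤ ∑ n ∈ Finset.Icc 1 (M - 1), g n := Finset.sum_nonneg fun _ _ => h0 _
  -- For `M ≤ 1` there are at most as many pulls as arms, and each of them costs at most `1`.
  rcases le_or_gt M 1 with h1 | h1
  · have : ∑ i ∈ s, ∑ n ∈ Finset.range (N i),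
        (if ⌊ε * n⌋₊ = 0 then 0 else min 1 (T * γ i (oldest ε n))) ≤ ∑ i ∈ s, (N i : ℝ) := by
      refine Finset.sum_le_sum fun i _ => ?_
      refine (Finset.sum_le_card_nsmul _ _ 1 fun n _ => ?_).trans (by simp)
      split_ifs
      · exact zero_le_one
      · exact min_le_left _ _
    refine this.trans ?_
    have h2 : ∑ i ∈ s, N i ≤ s.card :=
      hN.trans (hM.trans ((Nat.mul_le_mul_left _ h1).trans (by simp)))
    have h3 : (∑ i ∈ s, (N i : ℝ)) ≤ s.card := by exact_mod_cast h2
    have : 0 ≤ 3 * ⌈1 / (1 - 2 * ε)⌉₊ *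
          (s.card * (T : ℝ) ^ q * ∑ n ∈ Finset.Icc 1 (M - 1), g n) := by positivity
    linarith
  · have hpull : ∀ i ∈ s, ∑ n ∈ Finset.range (N i),
        (if ⌊ε * n⌋₊ = 0 then 0 else min 1 (T * γ i (oldest ε n)))
        ≤ (T : ℝ) ^ q * (⌈1 / (1 - 2 * ε)⌉₊ * ∑ n ∈ Finset.Icc 1 (N i), g n) := by
      intro i hi
      have hNi : N i ≤ T := (Finset.single_le_sum (fun _ _ => Nat.zero_le _) hi).trans hN
      refine le_trans ?_
        (mul_le_mul_of_nonneg_left (sum_oldest_le hε hε' h0 hg (N i)) (by positivity))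
      rw [Finset.mul_sum]
      refine Finset.sum_le_sum fun n hn => ?_
      rw [Finset.mem_range] at hn
      split_ifs with h
      · exact mul_nonneg (by positivity) (h0 _)
      · have hlt := oldest_lt hε hε' h
        obtain ⟨ha, hb⟩ := hγ i (oldest ε n) (by simp [oldest]) (by omega)
        refine (min_one_le_rpow (by positivity) hq hq').trans ?_
        rw [Real.mul_rpow (by positivity) ha]
        gcongr
    have hJ := sum_sum_Icc_le h0 hg s N h1 (hN.trans hM)
    calc _ ≤ ∑ i ∈ s, (T : ℝ) ^ q * (⌈1 / (1 - 2 * ε)⌉₊ * ∑ n ∈ Finset.Icc 1 (N i), g n) :=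
          Finset.sum_le_sum hpull
      _ = (T : ℝ) ^ q * (⌈1 / (1 - 2 * ε)⌉₊ * ∑ i ∈ s, ∑ n ∈ Finset.Icc 1 (N i), g n) := by
          rw [← Finset.mul_sum, ← Finset.mul_sum]
      _ ≤ (T : ℝ) ^ q * (⌈1 / (1 - 2 * ε)⌉₊ * (3 * s.card * ∑ n ∈ Finset.Icc 1 (M - 1), g n)) := by
          gcongr
      _ = 3 * ⌈1 / (1 - 2 * ε)⌉₊ *
          (s.card * (T : ℝ) ^ q * ∑ n ∈ Finset.Icc 1 (M - 1), g n) := by ring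
      _ ≤ _ := by linarith [Nat.cast_nonneg (α := ℝ) s.card]

/-- Choice of the number `x = T^{2q/(1+q)} U^{1/(1+q)}` of initial pulls that are charged the
maximal cost `1`: it balances `x` against `T^{2q} x^{-q} U`. -/
theorem exists_balance {ε : ℝ} (hε : 0 < ε) (hε' : ε < 1 / 2) {T : ℝ} (hT : 0 < T) {q U : ℝ}
    (hq : 0 ≤ q) (hq' : q ≤ 1) (hU : 0 ≤ U) :
    ∃ z : ℝ, 0 ≤ z ∧ z * U ≤ 2 / ε * (T ^ (2 * q / (1 + q)) * U ^ (1 / (1 + q))) ∧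
      ∀ n : ℝ, 1 ≤ n → T ^ (2 * q / (1 + q)) * U ^ (1 / (1 + q)) ≤ n →
        (T * (T / (ε * n / 2))) ^ q ≤ z := by
  have h2ε : 1 ≤ 2 / ε := by rw [le_div_iff₀ hε]; linarith
  have h2q : (2 / ε) ^ q ≤ 2 / ε := by
    simpa using Real.rpow_le_rpow_of_exponent_le h2ε hq'
  have key : ∀ n : ℝ, 0 < n → (T * (T / (ε * n / 2))) ^ q
      = (2 / ε) ^ q * T ^ (2 * q) * (n ^ q)⁻¹ := by
    intro n hn
    have : T * (T / (ε * n / 2)) = 2 / ε * T ^ (2 : ℝ) * n⁻¹ := by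
      rw [Real.rpow_two]; field_simp
    rw [this, Real.mul_rpow (by positivity) (by positivity),
      Real.mul_rpow (by positivity) (by positivity), ← Real.rpow_mul hT.le, Real.inv_rpow hn.le]
  rcases hU.eq_or_lt with rfl | hU
  · refine ⟨2 / ε * T ^ (2 * q), by positivity, ?_, fun n hn _ => ?_⟩
    · rw [mul_zero]; positivity
    · rw [key n (by linarith)]
      calc (2 / ε) ^ q * T ^ (2 * q) * (n ^ q)⁻¹ ≤ 2 / ε * T ^ (2 * q) * 1 := by
            gcongr
            exact inv_le_one_of_one_le₀ (Real.one_le_rpow hn hq)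
        _ = _ := mul_one _
  · set x := T ^ (2 * q / (1 + q)) * U ^ (1 / (1 + q)) with hx
    have hx0 : 0 < x := by positivity
    have hxq : x * x ^ q = T ^ (2 * q) * U := by
      rw [mul_comm, ← Real.rpow_add_one hx0.ne', hx,
        Real.mul_rpow (by positivity) (by positivity), ← Real.rpow_mul hT.le,
        ← Real.rpow_mul hU.le]
      have h1 : 2 * q / (1 + q) * (q + 1) = 2 * q := by field_simp; ring
      have h2 : 1 / (1 + q) * (q + 1) = 1 := by field_simp; ring
      rw [h1, h2, Real.rpow_one]
    refine ⟨2 / ε * T ^ (2 * q) * (x ^ q)⁻¹, by positivity, le_of_eq ?_, fun n hn hxn => ?_⟩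
    · have : x = T ^ (2 * q) * U * (x ^ q)⁻¹ := by
        rw [← hxq, mul_assoc, mul_inv_cancel₀ (by positivity), mul_one]
      conv_rhs => rw [this]
      ring
    · rw [key n (by linarith)]
      gcongr

/-- Total contribution of the bias of the arms of a clique `s`. -/
theorem sum_restless_bias_le {ι : Type*} {ε : ℝ} (hε : 0 < ε) (hε' : ε < 1 / 2) {T : ℕ} {q : ℝ}
    (hq : 0 ≤ q) (hq' : q ≤ 1) {γ : ι → ℕ → ℝ} {g : ℕ → ℝ} (h0 : ∀ n, 0 ≤ g n)
    (hg : ∀ a b, 1 ≤ a → a ≤ b → g b ≤ g a)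
    (hγ : ∀ i n, 1 ≤ n → n + 1 ≤ T → 0 ≤ γ i n ∧ γ i n ^ q ≤ g n)
    (s : Finset ι) (N : ι → ℕ) {M : ℕ} (hN : ∑ i ∈ s, N i ≤ T) (hM : T ≤ s.card * M) :
    ∑ i ∈ s, ∑ n ∈ Finset.range (N i),
        (if ⌊ε * n⌋₊ = 0 then 0 else min 1 (T * γ i (oldest ε n) * (T / ⌊ε * n⌋₊)))
      ≤ s.card + (1 + 6 / ε * ⌈1 / (1 - 2 * ε)⌉₊) * (s.card * ((T : ℝ) ^ (2 * q / (1 + q)) *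
          (∑ n ∈ Finset.Icc 1 (M - 1), g n) ^ (1 / (1 + q)))) := by
  have hΥ : 0 ≤ ∑ n ∈ Finset.Icc 1 (M - 1), g n := Finset.sum_nonneg fun _ _ => h0 _
  set U := ∑ n ∈ Finset.Icc 1 (M - 1), g n with hU
  set x := (T : ℝ) ^ (2 * q / (1 + q)) * U ^ (1 / (1 + q)) with hx
  have hx0 : 0 ≤ x := by positivity
  set D : ℝ := (⌈1 / (1 - 2 * ε)⌉₊ : ℝ) with hD
  have hD0 : 0 ≤ D := by positivity
  -- For `M ≤ 1` there are at most as many pulls as arms, and each of them costs at most `1`.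
  rcases le_or_gt M 1 with h1 | h1
  · have : ∑ i ∈ s, ∑ n ∈ Finset.range (N i),
        (if ⌊ε * n⌋₊ = 0 then 0 else min 1 (T * γ i (oldest ε n) * (T / ⌊ε * n⌋₊)))
          ≤ ∑ i ∈ s, (N i : ℝ) := by
      refine Finset.sum_le_sum fun i _ => ?_
      refine (Finset.sum_le_card_nsmul _ _ 1 fun n _ => ?_).trans (by simp)
      split_ifs
      · exact zero_le_one
      · exact min_le_left _ _
    refine this.trans ?_
    have h2 : ∑ i ∈ s, N i ≤ s.card :=
      hN.trans (hM.trans ((Nat.mul_le_mul_left _ h1).trans (by simp)))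
    have h3 : (∑ i ∈ s, (N i : ℝ)) ≤ s.card := by exact_mod_cast h2
    have : 0 ≤ (1 + 6 / ε * D) * (s.card * x) := by positivity
    linarith
  rcases Nat.eq_zero_or_pos T with hT | hT
  · have : ∀ i ∈ s, N i = 0 := fun i hi => by
      have := (Finset.single_le_sum (fun _ _ => Nat.zero_le _) hi).trans hN
      omega
    rw [Finset.sum_eq_zero fun i hi => by rw [this i hi]; simp]
    positivity
  have hT' : (0 : ℝ) < T := by exact_mod_cast hT
  obtain ⟨z, hz0, hzU, hz⟩ := exists_balance hε hε' hT' hq hq' hΥ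
  have hpull : ∀ i ∈ s, ∑ n ∈ Finset.range (N i),
      (if ⌊ε * n⌋₊ = 0 then 0 else min 1 (T * γ i (oldest ε n) * (T / ⌊ε * n⌋₊)))
      ≤ (x + 1) + z * (D * ∑ n ∈ Finset.Icc 1 (N i), g n) := by
    intro i hi
    have hNi : N i ≤ T := (Finset.single_le_sum (fun _ _ => Nat.zero_le _) hi).trans hN
    have hcount : ∑ n ∈ Finset.range (N i), (if (n : ℝ) ≤ x then (1 : ℝ) else 0) ≤ x + 1 := by
      rw [← Finset.sum_filter, Finset.sum_const, nsmul_eq_mul, mul_one]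
      have hsub : (Finset.range (N i)).filter (fun n : ℕ => (n : ℝ) ≤ x)
          ⊆ Finset.range (⌊x⌋₊ + 1) := by
        intro n hn
        rw [Finset.mem_filter] at hn
        exact Finset.mem_range.2 (Nat.lt_succ_of_le (Nat.le_floor hn.2))
      have h2 := Finset.card_le_card hsub
      rw [Finset.card_range] at h2
      have h3 : (((Finset.range (N i)).filter (fun n : ℕ => (n : ℝ) ≤ x)).card : ℝ)
          ≤ ⌊x⌋₊ + 1 := by exact_mod_cast h2
      linarith [Nat.floor_le hx0]
    refine le_trans ?_ (add_le_add hcount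
        (mul_le_mul_of_nonneg_left (sum_oldest_le hε hε' h0 hg (N i)) hz0))
    rw [Finset.mul_sum, ← Finset.sum_add_distrib]
    refine Finset.sum_le_sum fun n hn => ?_
    rw [Finset.mem_range] at hn
    have hzg : 0 ≤ z * g (oldest ε n) := mul_nonneg hz0 (h0 _)
    split_ifs with h h' h'
    · linarith
    · linarith
    · linarith [min_le_left (1 : ℝ) (T * γ i (oldest ε n) * (T / ⌊ε * n⌋₊))]
    · have hlt := oldest_lt hε hε' h
      have hn1 := one_le_of_floor_ne_zero h
      have hn1' : (1 : ℝ) ≤ n := by exact_mod_cast hn1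
      obtain ⟨ha, hb⟩ := hγ i (oldest ε n) (by simp [oldest]) (by omega)
      refine (min_one_le_rpow (by positivity) hq hq').trans ?_
      have e : (T : ℝ) * γ i (oldest ε n) * (T / ⌊ε * n⌋₊)
          = T * (T / ⌊ε * n⌋₊) * γ i (oldest ε n) := by ring
      rw [e, Real.mul_rpow (by positivity) ha, zero_add]
      refine mul_le_mul ?_ hb (by positivity) hz0
      refine le_trans ?_ (hz n hn1' (not_le.1 h').le)
      have := half_mul_le_floor n h
      gcongr
  have hJ := sum_sum_Icc_le h0 hg s N h1 (hN.trans hM)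
  calc _ ≤ ∑ i ∈ s, ((x + 1) + z * (D * ∑ n ∈ Finset.Icc 1 (N i), g n)) :=
        Finset.sum_le_sum hpull
    _ = s.card * (x + 1) + z * (D * ∑ i ∈ s, ∑ n ∈ Finset.Icc 1 (N i), g n) := by
        rw [Finset.sum_add_distrib, ← Finset.mul_sum, ← Finset.mul_sum]; simp; ring
    _ ≤ s.card * (x + 1) + z * (D * (3 * s.card * U)) := by gcongr
    _ = s.card * (x + 1) + 3 * D * s.card * (z * U) := by ring
    _ ≤ s.card * (x + 1) + 3 * D * s.card * (2 / ε * x) := by gcongr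
    _ = _ := by ring

/-! ### Combinatorics of histories -/

section History

variable {k t : ℕ}

/-- The number of pulls of arm `i` up to and including the round with index `s`. -/
def rank (H : History k t) (i : Fin k) (s : Fin t) : ℕ :=
  ((Finset.Iic s).filter fun τ => (H τ).1 = i).card

/-- The history available when the arm of the round with index `s` is chosen. -/
def before (H : History k t) (s : Fin t) : History k s := fun τ => H (Fin.castLE s.2.le τ)

theorem rank_eq_sum (H : History k t) (i : Fin k) (s : Fin t) :
    rank H i s = ∑ τ ∈ Finset.Iic s, if (H τ).1 = i then 1 else 0 := by
  rw [rank, Finset.card_filter]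

theorem pulls_eq_sum (H : History k t) (i : Fin k) :
    pulls H i = ∑ τ, if (H τ).1 = i then 1 else 0 := by
  rw [pulls, Finset.card_filter]

theorem rank_before (H : History k t) (s : Fin t) (i : Fin k) (τ : Fin s) :
    rank (before H s) i τ = rank H i (Fin.castLE s.2.le τ) := by
  rw [rank_eq_sum, rank_eq_sum, Fin.sum_Iic_castLE]
  rfl

theorem sum_before {M : Type*} [AddCommMonoid M] (s : Fin t) (f : Fin t → M) :
    ∑ τ : Fin s, f (Fin.castLE s.2.le τ) = ∑ τ ∈ Finset.Iio s, f τ := by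
  have : (Finset.univ : Finset (Fin s)).map (Fin.castLEEmb s.2.le) = Finset.Iio s := by
    ext a
    simp only [Finset.mem_map, Finset.mem_univ, true_and, Finset.mem_Iio]
    constructor
    · rintro ⟨b, rfl⟩
      exact b.2
    · intro h
      exact ⟨⟨a, h⟩, rfl⟩
  rw [← this, Finset.sum_map]
  rfl

theorem sum_Iic_eq {M : Type*} [AddCommMonoid M] (s : Fin t) (f : Fin t → M) :
    ∑ τ ∈ Finset.Iic s, f τ = ∑ τ ∈ Finset.Iio s, f τ + f s := by
  rw [← Finset.Iio_insert, Finset.sum_insert (by simp), add_comm]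

theorem rank_eq_pulls_before (H : History k t) (s : Fin t) :
    rank H (H s).1 s = pulls (before H s) (H s).1 + 1 := by
  rw [rank_eq_sum, pulls_eq_sum, sum_Iic_eq, if_pos rfl, ← sum_before]
  rfl

theorem pulls_before_le (H : History k t) (s : Fin t) (i : Fin k) :
    pulls (before H s) i ≤ s := by
  refine (Finset.card_filter_le _ _).trans ?_
  simp

theorem rank_lt_rank (H : History k t) {i : Fin k} {s s' : Fin t} (h : s < s')
    (hs : (H s').1 = i) : rank H i s < rank H i s' := by
  refine Finset.card_lt_card ?_
  rw [Finset.ssubset_iff_of_subset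
    (Finset.filter_subset_filter _ (Finset.Iic_subset_Iic.2 h.le))]
  exact ⟨s', by simp [hs], by simp [h]⟩

theorem rank_injOn (H : History k t) {i : Fin k} {s s' : Fin t} (hs : (H s).1 = i)
    (hs' : (H s').1 = i) (h : rank H i s = rank H i s') : s = s' := by
  rcases lt_trichotomy s s' with h1 | h1 | h1
  · exact absurd h (rank_lt_rank H h1 hs').ne
  · exact h1
  · exact absurd h (rank_lt_rank H h1 hs).ne'

theorem rank_mem_Icc (H : History k t) {i : Fin k} {s : Fin t} (hs : (H s).1 = i) :
    rank H i s ∈ Finset.Icc 1 (pulls H i) := by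
  rw [Finset.mem_Icc]
  exact ⟨Finset.card_pos.2 ⟨s, by simp [hs]⟩,
    Finset.card_le_card (Finset.filter_subset_filter _ (Finset.subset_univ _))⟩

theorem image_rank (H : History k t) (i : Fin k) :
    (Finset.univ.filter fun s => (H s).1 = i).image (rank H i) = Finset.Icc 1 (pulls H i) := by
  refine Finset.eq_of_subset_of_card_le ?_ ?_
  · intro l hl
    obtain ⟨s, hs, rfl⟩ := Finset.mem_image.1 hl
    exact rank_mem_Icc H (Finset.mem_filter.1 hs).2
  · rw [Finset.card_image_of_injOn]
    · simp [pulls]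
    · intro s hs s' hs' h
      exact rank_injOn H (by simpa using hs) (by simpa using hs') h

theorem exists_rank_eq (H : History k t) (i : Fin k) {l : ℕ} (h1 : 1 ≤ l) (h2 : l ≤ pulls H i) :
    ∃ s, (H s).1 = i ∧ rank H i s = l := by
  have : l ∈ Finset.Icc 1 (pulls H i) := Finset.mem_Icc.2 ⟨h1, h2⟩
  rw [← image_rank] at this
  simpa using this

/-- A sum over rounds of a function of (arm pulled, number of earlier pulls of that arm) is a sum
over arms and pulls. -/
theorem sum_pulls_before (H : History k t) (F : Fin k → ℕ → ℝ) :
    ∑ s, F (H s).1 (pulls (before H s) (H s).1)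
      = ∑ i, ∑ n ∈ Finset.range (pulls H i), F i n := by
  rw [← Finset.sum_fiberwise (s := Finset.univ) (g := fun s => (H s).1)]
  refine Finset.sum_congr rfl fun i _ => ?_
  have e : ∑ n ∈ Finset.range (pulls H i), F i n = ∑ n ∈ Finset.Icc 1 (pulls H i), F i (n - 1) := by
    rw [Finset.range_eq_Ico, Finset.sum_Ico_eq_sum_range, ← Finset.Ico_add_one_right_eq_Icc,
      Finset.sum_Ico_eq_sum_range]
    simp
  rw [e, ← image_rank, Finset.sum_image]
  · refine Finset.sum_congr rfl fun s hs => ?_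
    have hs' : (H s).1 = i := (Finset.mem_filter.1 hs).2
    subst hs'
    rw [rank_eq_pulls_before, Nat.add_sub_cancel]
  · intro s hs s' hs' h
    exact rank_injOn H (by simpa using hs) (by simpa using hs') h

theorem sum_pulls (H : History k t) : ∑ i, pulls H i = t := by
  simp only [pulls_eq_sum]
  rw [Finset.sum_comm]
  simp

/-! ### The pulls as a process in the number of pulls -/

/-- The value of `x` in the round of the `l`-th pull of arm `i`, encoded like `obs` as a sum over the
rounds; it is `0` if there are fewer than `l` pulls. -/
def atPull (H : History k t) (x : Fin t → ℝ) (i : Fin k) (l : ℕ) : ℝ :=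
  ∑ s, if (H s).1 = i ∧ rank H i s = l then x s else 0

theorem obs_eq_atPull (H : History k t) (i : Fin k) (l : ℕ) :
    obs H i l = atPull H (fun s => (H s).2) i l := rfl

theorem atPull_rank (H : History k t) (x : Fin t → ℝ) {i : Fin k} {s : Fin t}
    (hs : (H s).1 = i) : atPull H x i (rank H i s) = x s := by
  rw [atPull, Finset.sum_eq_single s]
  · rw [if_pos ⟨hs, rfl⟩]
  · intro s' _ hne
    rw [if_neg]
    rintro ⟨h1, h2⟩
    exact hne (rank_injOn H h1 hs h2)
  · simp

theorem obs_before (H : History k t) (s : Fin t) (i : Fin k) {l : ℕ} (h1 : 1 ≤ l)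
    (h2 : l ≤ pulls (before H s) i) : obs (before H s) i l = obs H i l := by
  obtain ⟨τ, hτ, rfl⟩ := exists_rank_eq (before H s) i h1 h2
  rw [obs_eq_atPull, atPull_rank _ _ hτ, rank_before, obs_eq_atPull]
  exact (atPull_rank H (fun s => (H s).2) (s := Fin.castLE s.2.le τ) hτ).symm

variable {G : Matrix (Fin k) (Fin k) ℕ}

theorem IsBlockDiagonal.diag {𝒞 : Finpartition (Finset.univ : Finset (Fin k))}
    (hG : IsBlockDiagonal G 𝒞) (i : Fin k) : G i i = 1 := by
  refine (hG i i).1 ?_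
  obtain ⟨C, hC, hi⟩ := 𝒞.exists_mem (Finset.mem_univ i)
  exact ⟨C, hC, hi, hi⟩

theorem IsBlockDiagonal.le_one {𝒞 : Finpartition (Finset.univ : Finset (Fin k))}
    (hG : IsBlockDiagonal G 𝒞) (i j : Fin k) : G i j ≤ 1 := by
  by_cases h : ∃ C ∈ 𝒞.parts, i ∈ C ∧ j ∈ C
  · exact ((hG i j).1 h).le
  · exact ((hG i j).2 h).le.trans zero_le_one

/-- An arm whose clique is a singleton is triggered by its own pulls only. -/
theorem IsBlockDiagonal.eq_ite {𝒞 : Finpartition (Finset.univ : Finset (Fin k))}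
    (hG : IsBlockDiagonal G 𝒞) {C : Finset (Fin k)} (hC : C ∈ 𝒞.parts) {i : Fin k} (hi : i ∈ C)
    (h1 : C.card = 1) (j : Fin k) : G j i = if j = i then 1 else 0 := by
  split_ifs with h
  · subst h
    exact hG.diag j
  · refine (hG j i).2 ?_
    rintro ⟨C', hC', hj, hi'⟩
    obtain rfl : C = C' := 𝒞.eq_of_mem_parts hC hC' hi hi'
    exact h (Finset.card_le_one.1 h1.le _ hj _ hi)

theorem triggers_le (hG1 : ∀ i j, G i j ≤ 1) (H : History k t) (s : Fin t) (i : Fin k) :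
    triggers G H s i ≤ s + 1 := by
  refine (Finset.sum_le_card_nsmul _ _ 1 fun _ _ => hG1 _ _).trans ?_
  simp

theorem rank_le_triggers (hG : ∀ i, G i i = 1) (H : History k t) (s : Fin t) (i : Fin k) :
    rank H i s ≤ triggers G H s i := by
  rw [rank_eq_sum, triggers]
  refine Finset.sum_le_sum fun τ _ => ?_
  split_ifs with h
  · rw [h, hG]
  · exact Nat.zero_le _

/-- Between two rounds, an arm is triggered at least as often as it is pulled. -/
theorem triggers_add_rank_le (hG : ∀ i, G i i = 1) (H : History k t) {s s' : Fin t} (h : s ≤ s')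
    (i : Fin k) : triggers G H s i + rank H i s' ≤ triggers G H s' i + rank H i s := by
  rw [rank_eq_sum, rank_eq_sum, triggers, triggers]
  have hsub := Finset.Iic_subset_Iic.2 h
  rw [← Finset.sum_sdiff hsub (f := fun τ => if (H τ).1 = i then 1 else 0),
    ← Finset.sum_sdiff hsub (f := fun τ => G (H τ).1 i)]
  have : ∑ τ ∈ Finset.Iic s' \ Finset.Iic s, (if (H τ).1 = i then 1 else 0)
      ≤ ∑ τ ∈ Finset.Iic s' \ Finset.Iic s, G (H τ).1 i := by
    refine Finset.sum_le_sum fun τ _ => ?_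
    split_ifs with h
    · rw [h, hG]
    · exact Nat.zero_le _
  omega

theorem triggers_mono (H : History k t) {s s' : Fin t} (h : s ≤ s') (i : Fin k) :
    triggers G H s i ≤ triggers G H s' i :=
  Finset.sum_le_sum_of_subset (Finset.Iic_subset_Iic.2 h)

theorem triggers_eq_rank {i : Fin k} (hG : ∀ j, G j i = if j = i then 1 else 0) (H : History k t)
    (s : Fin t) : triggers G H s i = rank H i s := by
  rw [rank_eq_sum, triggers]
  exact Finset.sum_congr rfl fun τ _ => hG _

/-- The expected reward at the `l`-th pull of arm `i`, given the number of triggers at that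
time. -/
noncomputable def meanObs (ν : Fin k → ℕ → Measure ℝ) (G : Matrix (Fin k) (Fin k) ℕ)
    (H : History k t) (i : Fin k) (l : ℕ) : ℝ :=
  atPull H (fun s => mean ν i (triggers G H s i)) i l

/-- Two pulls `l' < l` that precede the round with index `s` happen at numbers of triggers `a < b`
at least `l - l'` apart. -/
theorem exists_triggers (hG : ∀ i, G i i = 1) (hG1 : ∀ i j, G i j ≤ 1)
    (ν : Fin k → ℕ → Measure ℝ) (H : History k t) (s : Fin t) (i : Fin k) {l' l : ℕ}
    (h1 : 1 ≤ l') (h2 : l' < l) (h3 : l ≤ pulls (before H s) i) :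
    ∃ a b : ℕ, meanObs ν G H i l' = mean ν i a ∧ meanObs ν G H i l = mean ν i b ∧
      l' ≤ a ∧ l ≤ b ∧ a + (l - l') ≤ b ∧ b ≤ s ∧ b ≤ triggers G H s i ∧
      ((∀ j, G j i = if j = i then 1 else 0) → a = l' ∧ b = l) := by
  obtain ⟨τ', hτ', hr'⟩ := exists_rank_eq (before H s) i h1 (by omega)
  obtain ⟨τ, hτ, hr⟩ := exists_rank_eq (before H s) i (by omega) h3
  rw [rank_before] at hr hr'
  set u' := Fin.castLE s.2.le τ' with hu'
  set u := Fin.castLE s.2.le τ with hu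
  have hus : u < s := τ.2
  have hHu : (H u).1 = i := hτ
  have hHu' : (H u').1 = i := hτ'
  have hlt : u' ≤ u := by
    by_contra hcon
    have := rank_lt_rank H (not_le.1 hcon) hHu'
    omega
  refine ⟨triggers G H u' i, triggers G H u i, ?_, ?_, ?_, ?_, ?_, ?_, ?_, ?_⟩
  · rw [← hr', meanObs, atPull_rank _ _ hHu']
  · rw [← hr, meanObs, atPull_rank _ _ hHu]
  · rw [← hr']
    exact rank_le_triggers hG H _ _
  · rw [← hr]
    exact rank_le_triggers hG H _ _
  · have := triggers_add_rank_le hG H hlt i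
    omega
  · exact (triggers_le hG1 H u i).trans hus
  · exact triggers_mono H hus.le i
  · intro hs
    exact ⟨by rw [triggers_eq_rank hs, hr'], by rw [triggers_eq_rank hs, hr]⟩

end History

/-! ### Rising rewards -/

section Rising

variable {k T : ℕ} {σ : ℝ≥0} {ν : Fin k → ℕ → Measure ℝ}

theorem IsRising.increment_anti (hν : IsRising ν T σ) (i : Fin k) {a b : ℕ} (ha : 1 ≤ a)
    (hab : a ≤ b) (hb : b + 1 ≤ T) : increment ν i b ≤ increment ν i a := by
  induction b, hab using Nat.le_induction with
  | base => exact le_rfl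
  | succ b hab ih => exact (hν.concave i b (by omega) (by omega)).trans (ih (by omega))

theorem IsRising.mean_mono (hν : IsRising ν T σ) (i : Fin k) {a b : ℕ} (ha : 1 ≤ a)
    (hab : a ≤ b) (hb : b ≤ T) : mean ν i a ≤ mean ν i b := by
  induction b, hab using Nat.le_induction with
  | base => exact le_rfl
  | succ b hab ih =>
    have := hν.nondecreasing i b (by omega) hb
    unfold increment at this
    linarith [ih (by omega)]

theorem IsRising.mean_sub_le (hν : IsRising ν T σ) (i : Fin k) {a b : ℕ} (ha : 1 ≤ a)
    (hab : a ≤ b) (hb : b ≤ T) :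
    mean ν i b - mean ν i a ≤ ((b : ℝ) - a) * increment ν i a := by
  induction b, hab using Nat.le_induction with
  | base => simp
  | succ b hab ih =>
    have h1 := ih (by omega)
    have h2 := hν.increment_anti i ha hab hb
    have h3 : mean ν i (b + 1) = mean ν i b + increment ν i b := by unfold increment; ring
    push_cast
    nlinarith

theorem IsRising.le_mean_sub (hν : IsRising ν T σ) (i : Fin k) {a b c : ℕ} (ha : 1 ≤ a)
    (hab : a ≤ b) (hbc : b ≤ c) (hc : c + 1 ≤ T) :
    ((b : ℝ) - a) * increment ν i c ≤ mean ν i b - mean ν i a := by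
  induction b, hab using Nat.le_induction with
  | base => simp
  | succ b hab ih =>
    have h1 := ih (by omega)
    have h2 := hν.increment_anti i (by omega : 1 ≤ b) (by omega : b ≤ c) hc
    have h3 : mean ν i (b + 1) = mean ν i b + increment ν i b := by unfold increment; ring
    push_cast
    nlinarith

/-- Linear extrapolation of a concave sequence from the past overestimates its future, even if the
elapsed time `r` and the length `h` of the past are counted in pulls instead of triggers. -/
theorem IsRising.mean_le_extrapolate (hν : IsRising ν T σ) (i : Fin k) {a b c h : ℕ} (ha : 1 ≤ a)
    (hh : 1 ≤ h) (hab : a + h ≤ b) (hbc : b ≤ c) (hc : c ≤ T) {r : ℝ} (hr : (c : ℝ) - b ≤ r) :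
    mean ν i c ≤ mean ν i b + r * ((mean ν i b - mean ν i a) / h) := by
  have hd := hν.mean_mono i ha (by omega : a ≤ b) (by omega)
  have hh' : (0 : ℝ) < h := by exact_mod_cast hh
  rcases hbc.eq_or_lt with rfl | hlt
  · have : 0 ≤ r * ((mean ν i b - mean ν i a) / h) := by
      refine mul_nonneg (by linarith) (div_nonneg (by linarith) hh'.le)
    linarith
  · have h1 := hν.mean_sub_le i (by omega : 1 ≤ b) hbc hc
    have h2 := hν.le_mean_sub i ha (by omega : a ≤ b) le_rfl (by omega)
    have h0 := hν.nondecreasing i b (by omega) (by omega)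
    have h3 : (h : ℝ) ≤ (b : ℝ) - a := by
      have : ((a + h : ℕ) : ℝ) ≤ b := by exact_mod_cast hab
      push_cast at this
      linarith
    have h4 : increment ν i b ≤ (mean ν i b - mean ν i a) / h := by
      rw [le_div_iff₀ hh']
      nlinarith
    have h5 : (0 : ℝ) ≤ (c : ℝ) - b := by
      have : (b : ℝ) ≤ c := by exact_mod_cast hbc
      linarith
    have := mul_le_mul hr h4 h0 (h5.trans hr)
    linarith

end Rising

/-! ### The estimator -/

/-- The estimator of the algorithm in round `t`, after `N` pulls and with window `h`, as a function
of the sequence `x` of the rewards of the successive pulls. -/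
noncomputable def extrapolate (x : ℕ → ℝ) (t N h : ℕ) : ℝ :=
  (1 / (h : ℝ)) * ∑ l ∈ Finset.Icc (N - h + 1) N, (x l + ((t : ℝ) - l) * ((x l - x (l - h)) / h))

theorem estimator_eq {k t : ℕ} (H : History k t) (i : Fin k) (h : ℕ) :
    estimator H i h = extrapolate (obs H i) (t + 1) (pulls H i) h := rfl

theorem le_extrapolate {x : ℕ → ℝ} {t N h : ℕ} {c : ℝ} (hh : 1 ≤ h) (hN : h ≤ N)
    (H : ∀ l ∈ Finset.Icc (N - h + 1) N, c ≤ x l + ((t : ℝ) - l) * ((x l - x (l - h)) / h)) :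
    c ≤ extrapolate x t N h := by
  have hh' : (0 : ℝ) < h := by exact_mod_cast hh
  have := Finset.card_nsmul_le_sum _ _ c H
  rw [Nat.card_Icc, show N + 1 - (N - h + 1) = h by omega, nsmul_eq_mul] at this
  rw [extrapolate, one_div, ← div_eq_inv_mul, le_div_iff₀ hh']
  linarith

theorem extrapolate_le {x : ℕ → ℝ} {t N h : ℕ} {c : ℝ} (hh : 1 ≤ h) (hN : h ≤ N)
    (H : ∀ l ∈ Finset.Icc (N - h + 1) N, x l + ((t : ℝ) - l) * ((x l - x (l - h)) / h) ≤ c) :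
    extrapolate x t N h ≤ c := by
  have hh' : (0 : ℝ) < h := by exact_mod_cast hh
  have := Finset.sum_le_card_nsmul _ _ c H
  rw [Nat.card_Icc, show N + 1 - (N - h + 1) = h by omega, nsmul_eq_mul] at this
  rw [extrapolate, one_div, ← div_eq_inv_mul, div_le_iff₀ hh']
  linarith

section Optimism

variable {k T : ℕ} {σ : ℝ≥0} {ν : Fin k → ℕ → Measure ℝ} {G : Matrix (Fin k) (Fin k) ℕ}
  {ε : ℝ} (H : History k T) (s : Fin T) (i : Fin k)

/-- Optimism: freed of the noise, the estimator of any arm overestimates the expected reward that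
the arm would have if it had been triggered in every round. -/
theorem mean_le_extrapolate_meanObs (hν : IsRising ν T σ) (hG : ∀ i, G i i = 1)
    (hG1 : ∀ i j, G i j ≤ 1) (hε : 0 < ε) (hε' : ε < 1 / 2)
    (h : ⌊ε * pulls (before H s) i⌋₊ ≠ 0) :
    mean ν i (s + 1) ≤ extrapolate (meanObs ν G H i) (s + 1) (pulls (before H s) i)
      ⌊ε * pulls (before H s) i⌋₊ := by
  have h2 := two_mul_floor_le hε hε' (pulls (before H s) i)
  refine le_extrapolate (by omega) (by omega) fun l hl => ?_
  rw [Finset.mem_Icc] at hl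
  obtain ⟨a, b, ea, eb, h3, h4, h5, h6, -⟩ := exists_triggers hG hG1 ν H s i
    (l' := l - ⌊ε * pulls (before H s) i⌋₊) (l := l) (by omega) (by omega) hl.2
  rw [ea, eb]
  refine hν.mean_le_extrapolate i (by omega) (by omega) (by omega) (by omega) (by omega) ?_
  have : (l : ℝ) ≤ b := by exact_mod_cast h4
  push_cast
  linarith

/-- The bias of the estimator of the arm that is pulled. The clique of the arm enters through a
bound `W` on the number of triggers between the two ends of a window. -/
theorem extrapolate_meanObs_le (hν : IsRising ν T σ) (hG : ∀ i, G i i = 1)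
    (hG1 : ∀ i j, G i j ≤ 1) (hε : 0 < ε) (hε' : ε < 1 / 2)
    (h : ⌊ε * pulls (before H s) i⌋₊ ≠ 0) {W : ℝ} (hW : W = T ∨
      W = ⌊ε * pulls (before H s) i⌋₊ ∧ ∀ j, G j i = if j = i then 1 else 0) :
    extrapolate (meanObs ν G H i) (s + 1) (pulls (before H s) i) ⌊ε * pulls (before H s) i⌋₊ ≤
      mean ν i (triggers G H s i) + T * increment ν i (oldest ε (pulls (before H s) i)) *
        (W / ⌊ε * pulls (before H s) i⌋₊) := by
  have h2 := two_mul_floor_le hε hε' (pulls (before H s) i)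
  have hsT := s.2
  refine extrapolate_le (by omega) (by omega) fun l hl => ?_
  rw [Finset.mem_Icc] at hl
  set w := ⌊ε * pulls (before H s) i⌋₊ with hw
  have hw' : (0 : ℝ) < w := by exact_mod_cast Nat.pos_of_ne_zero h
  obtain ⟨a, b, ea, eb, h3, h4, h5, h6, h7, h8⟩ := exists_triggers hG hG1 ν H s i
    (l' := l - w) (l := l) (by omega) (by omega) hl.2
  rw [ea, eb]
  have hold : oldest ε (pulls (before H s) i) ≤ a := by
    unfold oldest
    rw [← hw]
    omega
  have htr := triggers_le hG1 H s i
  have hm := hν.mean_mono i (by omega : 1 ≤ b) h7 (by omega)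
  have hd0 := hν.mean_mono i (by omega : 1 ≤ a) (by omega : a ≤ b) (by omega)
  have hd := hν.mean_sub_le i (by omega : 1 ≤ a) (by omega : a ≤ b) (by omega)
  have hγ := hν.increment_anti i (by simp [oldest]) hold (by omega)
  have hγ0 := hν.nondecreasing i a (by omega) (by omega)
  have hbW : (b : ℝ) - a ≤ W := by
    rcases hW with rfl | ⟨rfl, hs⟩
    · have : (b : ℝ) ≤ T := by exact_mod_cast (by omega : b ≤ T)
      linarith [Nat.cast_nonneg (α := ℝ) a]
    · obtain ⟨rfl, rfl⟩ := h8 hs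
      rw [Nat.cast_sub (by omega)]
      linarith
  have hba : (0 : ℝ) ≤ (b : ℝ) - a := by
    have : (a : ℝ) ≤ b := by exact_mod_cast (by omega : a ≤ b)
    linarith
  have hd' : mean ν i b - mean ν i a
      ≤ increment ν i (oldest ε (pulls (before H s) i)) * W := by
    refine hd.trans ?_
    rw [mul_comm]
    exact mul_le_mul hγ hbW hba (hγ0.trans hγ)
  have hr : ((s + 1 : ℕ) : ℝ) - l ≤ T := by
    have : ((s + 1 : ℕ) : ℝ) ≤ T := by exact_mod_cast hsT
    linarith [Nat.cast_nonneg (α := ℝ) l]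
  have h9 : (((s + 1 : ℕ) : ℝ) - l) * ((mean ν i b - mean ν i a) / w)
      ≤ T * ((increment ν i (oldest ε (pulls (before H s) i)) * W) / w) := by
    refine mul_le_mul hr (by gcongr) (div_nonneg (by linarith) hw'.le) (by positivity)
  have e : T * increment ν i (oldest ε (pulls (before H s) i)) * (W / w)
      = T * ((increment ν i (oldest ε (pulls (before H s) i)) * W) / w) := by ring
  rw [e]
  linarith

end Optimism

/-! ### The noise of the estimator -/

/-- The coefficient of the reward of the `l`-th pull in the estimator. -/
noncomputable def coeff (t N h l : ℕ) : ℝ :=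
  if N - h + 1 ≤ l ∧ l ≤ N then (1 / (h : ℝ)) * (1 + ((t : ℝ) - l) / h)
  else if N - 2 * h + 1 ≤ l ∧ l ≤ N - h then -((1 / (h : ℝ)) * (((t : ℝ) - l - h) / h))
  else 0

theorem coeff_eq_zero {t N h l : ℕ} (hl : l ∉ Finset.Icc 1 N) : coeff t N h l = 0 := by
  rw [Finset.mem_Icc] at hl
  rw [coeff, if_neg (by omega), if_neg (by omega)]

/-- A sum over the pulls, split into the recent half of the window and the older half, the latter
shifted by `h`. -/
theorem sum_coeff_eq_add {t N h : ℕ} (hh : 1 ≤ h) (hN : 2 * h ≤ N) (F : ℝ → ℕ → ℝ)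
    (hF : ∀ l, F 0 l = 0) :
    ∑ l ∈ Finset.Icc 1 N, F (coeff t N h l) l
      = ∑ l ∈ Finset.Icc (N - h + 1) N, F ((1 / (h : ℝ)) * (1 + ((t : ℝ) - l) / h)) l
        + ∑ l ∈ Finset.Icc (N - h + 1) N,
            F (-((1 / (h : ℝ)) * (((t : ℝ) - l) / h))) (l - h) := by
  have e2 : ∑ l ∈ Finset.Icc (N - h + 1) N, F (-((1 / (h : ℝ)) * (((t : ℝ) - l) / h))) (l - h)
      = ∑ l ∈ Finset.Icc (N - 2 * h + 1) (N - h),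
          F (-((1 / (h : ℝ)) * (((t : ℝ) - l - h) / h))) l := by
    refine Finset.sum_nbij' (fun l => l - h) (fun l => l + h) ?_ ?_ ?_ ?_ ?_
    · intro l hl
      simp only [Finset.mem_Icc] at hl ⊢
      omega
    · intro l hl
      simp only [Finset.mem_Icc] at hl ⊢
      omega
    · intro l hl
      simp only [Finset.mem_Icc] at hl
      omega
    · intro l hl
      simp
    · intro l hl
      simp only [Finset.mem_Icc] at hl
      rw [Nat.cast_sub (by omega)]
      congr 4
      ring
  have hdisj : Disjoint (Finset.Icc (N - h + 1) N) (Finset.Icc (N - 2 * h + 1) (N - h)) := by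
    rw [Finset.disjoint_left]
    intro l hl hl'
    simp only [Finset.mem_Icc] at hl hl'
    omega
  rw [e2, ← Finset.sum_subset (s₁ := Finset.Icc (N - h + 1) N ∪ Finset.Icc (N - 2 * h + 1) (N - h)),
    Finset.sum_union hdisj]
  · congr 1
    · refine Finset.sum_congr rfl fun l hl => ?_
      rw [Finset.mem_Icc] at hl
      rw [coeff, if_pos hl]
    · refine Finset.sum_congr rfl fun l hl => ?_
      rw [Finset.mem_Icc] at hl
      rw [coeff, if_neg (by omega), if_pos hl]
  · intro l hl
    simp only [Finset.mem_union, Finset.mem_Icc] at hl ⊢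
    omega
  · intro l _ hl
    simp only [Finset.mem_union, Finset.mem_Icc, not_or] at hl
    rw [coeff, if_neg hl.1, if_neg hl.2, hF]

theorem extrapolate_eq_sum (x : ℕ → ℝ) {t N h : ℕ} (hh : 1 ≤ h) (hN : 2 * h ≤ N) :
    extrapolate x t N h = ∑ l ∈ Finset.Icc 1 N, coeff t N h l * x l := by
  rw [sum_coeff_eq_add hh hN (fun c l => c * x l) (by simp), ← Finset.sum_add_distrib, extrapolate,
    Finset.mul_sum]
  refine Finset.sum_congr rfl fun l _ => ?_
  ring

/-- The variance proxy of the estimator; it is what the bonus is calibrated to. -/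
theorem sum_coeff_sq_le {t N h : ℕ} (hh : 1 ≤ h) (hN : 2 * h ≤ N) (ht : N + 1 ≤ t) :
    ∑ l ∈ Finset.Icc 1 N, coeff t N h l ^ 2
      ≤ 5 * ((t : ℝ) - N + h - 1) ^ 2 / (h : ℝ) ^ 3 := by
  have hh' : (0 : ℝ) < h := by exact_mod_cast hh
  have ht' : (N : ℝ) + 1 ≤ t := by exact_mod_cast ht
  rw [sum_coeff_eq_add hh hN (fun c _ => c ^ 2) (by simp), ← Finset.sum_add_distrib]
  set a : ℝ := (t : ℝ) - N + h - 1 with ha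
  refine (Finset.sum_le_card_nsmul _ _ (5 * a ^ 2 / (h : ℝ) ^ 4) fun l hl => ?_).trans ?_
  · rw [Finset.mem_Icc] at hl
    have h1 : (N : ℝ) - h + 1 ≤ l := by
      have : N + 1 ≤ l + h := by omega
      have : (N : ℝ) + 1 ≤ l + h := by exact_mod_cast this
      linarith
    have h2 : (l : ℝ) ≤ N := by exact_mod_cast hl.2
    have h3 : (0 : ℝ) ≤ (t : ℝ) - l := by linarith
    have h4 : (t : ℝ) - l ≤ a := by linarith
    have e : ((1 / (h : ℝ)) * (1 + ((t : ℝ) - l) / h)) ^ 2 + (-((1 / (h : ℝ)) * (((t : ℝ) - l) / h))) ^ 2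
        = (((h : ℝ) + (t - l)) ^ 2 + (t - l) ^ 2) / (h : ℝ) ^ 4 := by
      field_simp
    rw [e]
    have h5 : ((h : ℝ) + (t - l)) ^ 2 ≤ (2 * a) ^ 2 := by
      refine pow_le_pow_left₀ (by linarith) (by linarith) 2
    have h6 : ((t : ℝ) - l) ^ 2 ≤ a ^ 2 := pow_le_pow_left₀ h3 h4 2
    gcongr
    linarith
  · rw [Nat.card_Icc, show N + 1 - (N - h + 1) = h by omega, nsmul_eq_mul]
    refine le_of_eq ?_
    field_simp

section Noise

variable {k t : ℕ} (ν : Fin k → ℕ → Measure ℝ) (G : Matrix (Fin k) (Fin k) ℕ)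

/-- The centered rewards of arm `i`, weighted by a function `c` of the rank of the pull. -/
noncomputable def noise (c : ℕ → ℝ) (i : Fin k) (H : History k t) : ℝ :=
  ∑ τ, if (H τ).1 = i then c (rank H i τ) * ((H τ).2 - mean ν i (triggers G H τ i)) else 0

theorem noise_eq_sum {c : ℕ → ℝ} {N : ℕ} (hc : ∀ l, l ∉ Finset.Icc 1 N → c l = 0) (i : Fin k)
    (H : History k t) :
    noise ν G c i H = ∑ l ∈ Finset.Icc 1 N, c l * (obs H i l - meanObs ν G H i l) := by
  have e : ∀ l, c l * (obs H i l - meanObs ν G H i l) = ∑ τ, if (H τ).1 = i ∧ rank H i τ = l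
      then c l * ((H τ).2 - mean ν i (triggers G H τ i)) else 0 := by
    intro l
    rw [obs_eq_atPull, meanObs, atPull, atPull, ← Finset.sum_sub_distrib, Finset.mul_sum]
    refine Finset.sum_congr rfl fun τ _ => ?_
    split_ifs <;> ring
  simp only [e]
  rw [Finset.sum_comm, noise]
  refine Finset.sum_congr rfl fun τ _ => ?_
  by_cases h : (H τ).1 = i
  · simp only [h, if_true, true_and]
    rw [Finset.sum_ite_eq]
    split_ifs with h'
    · rfl
    · rw [hc _ h', zero_mul]
  · simp [h]

/-- The deviation of the estimator from its noiseless version is a weighted sum of noises whose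
weights depend on the history through the number of pulls only. -/
theorem extrapolate_obs_sub (H : History k t) (s : Fin t) (i : Fin k) {h : ℕ} (hh : 1 ≤ h)
    (hN : 2 * h ≤ pulls (before H s) i) :
    estimator (before H s) i h
        - extrapolate (meanObs ν G H i) (s + 1) (pulls (before H s) i) h
      = noise ν G (coeff (s + 1) (pulls (before H s) i) h) i H := by
  rw [noise_eq_sum ν G (fun l hl => coeff_eq_zero hl), estimator_eq, extrapolate_eq_sum _ hh hN,
    extrapolate_eq_sum _ hh hN, ← Finset.sum_sub_distrib]
  refine Finset.sum_congr rfl fun l hl => ?_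
  rw [Finset.mem_Icc] at hl
  rw [obs_before H s i hl.1 hl.2]
  ring

/-! ### The law of the history -/

theorem measurable_of_arms {β : Type*} [MeasurableSpace β] (f : (Fin t → Fin k) → β) :
    Measurable fun H : History k t => f fun τ => (H τ).1 :=
  (measurable_of_countable f).comp (by fun_prop)

theorem measurable_noise (c : ℕ → ℝ) (i : Fin k) :
    Measurable (noise ν G c i : History k t → ℝ) := by
  refine Finset.measurable_sum _ fun τ _ => ?_
  refine Measurable.ite ?_ ?_ measurable_const
  · exact (show Measurable fun H : History k t => (H τ).1 by fun_prop) (measurableSet_singleton i)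
  · refine Measurable.mul ?_ (Measurable.sub (by fun_prop) ?_)
    · exact measurable_of_arms fun a =>
        c (((Finset.Iic τ).filter fun τ' => a τ' = i).card)
    · exact measurable_of_arms fun a => mean ν i (∑ τ' ∈ Finset.Iic τ, G (a τ') i)

theorem measurable_pulls (i : Fin k) : Measurable fun H : History k t => pulls H i :=
  measurable_of_arms fun a => (Finset.univ.filter fun τ => a τ = i).card

theorem measurable_snoc : Measurable fun p : History k t × (Fin k × ℝ) =>
    (Fin.snoc (α := fun _ => Fin k × ℝ) p.1 p.2 : History k (t + 1)) := by
  refine measurable_pi_iff.2 fun s => ?_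
  refine Fin.lastCases ?_ (fun s => ?_) s
  · simp only [Fin.snoc_last]
    fun_prop
  · simp only [Fin.snoc_castSucc]
    fun_prop

instance [∀ i n, IsProbabilityMeasure (ν i n)] (t : ℕ) : IsMarkovKernel (rewardKernel ν G t) :=
  ⟨fun p => inferInstanceAs (IsProbabilityMeasure (ν p.2 (∑ τ, G (p.1 τ).1 p.2 + G p.2 p.2)))⟩

instance [∀ i n, IsProbabilityMeasure (ν i n)] (π : Policy k) (t : ℕ) :
    IsProbabilityMeasure (historyLaw ν G π t) := by
  induction t with
  | zero => exact inferInstanceAs (IsProbabilityMeasure (Measure.dirac _))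
  | succ t ih =>
    exact Measure.isProbabilityMeasure_map measurable_snoc.aemeasurable

theorem lintegral_historyLaw_succ [∀ i n, IsProbabilityMeasure (ν i n)] (π : Policy k) (t : ℕ)
    {f : History k (t + 1) → ENNReal} (hf : Measurable f) :
    ∫⁻ H, f H ∂(historyLaw ν G π (t + 1))
      = ∫⁻ H, ∫⁻ i, ∫⁻ x, f (Fin.snoc (α := fun _ => Fin k × ℝ) H (i, x))
          ∂(ν i (∑ τ, G (H τ).1 i + G i i)) ∂(π.next t H) ∂(historyLaw ν G π t) := by
  have hm : Measurable fun p : History k t × (Fin k × ℝ) =>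
      f (Fin.snoc (α := fun _ => Fin k × ℝ) p.1 p.2) := hf.comp measurable_snoc
  rw [historyLaw, lintegral_map hf measurable_snoc, Measure.lintegral_compProd hm]
  refine lintegral_congr fun H => ?_
  exact Kernel.lintegral_compProd (π.next t) (rewardKernel ν G t) H
    (hm.comp (by fun_prop : Measurable fun b => (H, b)))

section Snoc

variable (H : History k t) (p : Fin k × ℝ)

theorem pulls_snoc (i : Fin k) :
    pulls (Fin.snoc (α := fun _ => Fin k × ℝ) H p : History k (t + 1)) i
      = pulls H i + if p.1 = i then 1 else 0 := by
  rw [pulls_eq_sum, pulls_eq_sum, Fin.sum_univ_castSucc]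
  simp only [Fin.snoc_castSucc, Fin.snoc_last]

theorem Iic_last : Finset.Iic (Fin.last t) = Finset.univ := by
  ext s
  simp [Fin.le_last]

theorem noise_snoc (c : ℕ → ℝ) (i : Fin k) :
    noise ν G c i (Fin.snoc (α := fun _ => Fin k × ℝ) H p : History k (t + 1))
      = noise ν G c i H + if p.1 = i then c (pulls H i + 1) *
          (p.2 - mean ν i (∑ τ, G (H τ).1 i + G i i)) else 0 := by
  rw [noise, noise, Fin.sum_univ_castSucc]
  congr 1
  · refine Finset.sum_congr rfl fun s _ => ?_
    simp only [rank_eq_sum, triggers, Fin.sum_Iic_castSucc, Fin.snoc_castSucc]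
  · simp only [rank_eq_sum, triggers, Iic_last, Fin.sum_univ_castSucc, Fin.snoc_castSucc,
      Fin.snoc_last, pulls_eq_sum]
    split_ifs with h
    · rw [h]
    · rfl

end Snoc

variable {ν G}

/-- The exponential supermartingale of the noise. -/
theorem lintegral_exp_noise_le [∀ i n, IsProbabilityMeasure (ν i n)] {T : ℕ} {σ : ℝ≥0}
    (hν : IsRising ν T σ) (hG : ∀ i, G i i = 1) (hG1 : ∀ i j, G i j ≤ 1) (π : Policy k)
    (c : ℕ → ℝ) (i : Fin k) (r : ℝ) (t : ℕ) (ht : t ≤ T) :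
    ∫⁻ H, ENNReal.ofReal (Real.exp (r * noise ν G c i H
      - (σ : ℝ) ^ 2 * r ^ 2 / 2 * ∑ l ∈ Finset.range (pulls H i + 1), c l ^ 2))
        ∂(historyLaw ν G π t) ≤ 1 := by
  have hmeas : ∀ t, Measurable fun H : History k t => ENNReal.ofReal (Real.exp (r * noise ν G c i H
      - (σ : ℝ) ^ 2 * r ^ 2 / 2 * ∑ l ∈ Finset.range (pulls H i + 1), c l ^ 2)) := by
    intro t
    have h1 := measurable_noise (t := t) ν G c i
    have h2 : Measurable fun H : History k t => ∑ l ∈ Finset.range (pulls H i + 1), c l ^ 2 :=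
      (measurable_of_countable fun n : ℕ => ∑ l ∈ Finset.range (n + 1), c l ^ 2).comp
        (measurable_pulls i)
    exact ((h1.const_mul r).sub (h2.const_mul _)).exp.ennreal_ofReal
  induction t with
  | zero =>
    rw [historyLaw, lintegral_dirac' _ (hmeas 0), ENNReal.ofReal_le_one, Real.exp_le_one_iff]
    have : noise ν G c i (Fin.elim0 : History k 0) = 0 := by simp [noise]
    rw [this]
    have : 0 ≤ (σ : ℝ) ^ 2 * r ^ 2 / 2 *
      ∑ l ∈ Finset.range (pulls (Fin.elim0 : History k 0) i + 1), c l ^ 2 := by positivity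
    linarith
  | succ t ih =>
    refine le_trans ?_ (ih (by omega))
    rw [lintegral_historyLaw_succ ν G π t (hmeas _)]
    refine lintegral_mono fun H => ?_
    set A := r * noise ν G c i H
      - (σ : ℝ) ^ 2 * r ^ 2 / 2 * ∑ l ∈ Finset.range (pulls H i + 1), c l ^ 2 with hA
    have hpull : ∀ j, ∫⁻ x, ENNReal.ofReal (Real.exp (
        r * noise ν G c i (Fin.snoc (α := fun _ => Fin k × ℝ) H (j, x) : History k (t + 1))
        - (σ : ℝ) ^ 2 * r ^ 2 / 2 * ∑ l ∈ Finset.range (pulls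
          (Fin.snoc (α := fun _ => Fin k × ℝ) H (j, x) : History k (t + 1)) i + 1), c l ^ 2))
        ∂(ν j (∑ τ, G (H τ).1 j + G j j)) ≤ ENNReal.ofReal (Real.exp A) := by
      intro j
      simp only [noise_snoc, pulls_snoc]
      by_cases hj : j = i
      · subst hj
        simp only [if_true]
        set n := ∑ τ, G (H τ).1 j + G j j with hn
        have hn1 : 1 ≤ n := by rw [hn, hG]; omega
        have hnT : n ≤ T := by
          have h1 : ∑ τ, G (H τ).1 j ≤ t := by
            refine (Finset.sum_le_card_nsmul _ _ 1 fun _ _ => hG1 _ _).trans ?_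
            simp
          have h2 := hG1 j j
          omega
        have hs := hν.subgaussian j n hn1 hnT
        set b := c (pulls H j + 1) with hb
        have e : ∀ x : ℝ, ENNReal.ofReal (Real.exp (r * (noise ν G c j H + b * (x - mean ν j n))
            - (σ : ℝ) ^ 2 * r ^ 2 / 2 * ∑ l ∈ Finset.range (pulls H j + 1 + 1), c l ^ 2))
            = ENNReal.ofReal (Real.exp (A - (σ : ℝ) ^ 2 * r ^ 2 / 2 * b ^ 2)) *
              ENNReal.ofReal (Real.exp (r * b * (x - mean ν j n))) := by
          intro x
          rw [← ENNReal.ofReal_mul (Real.exp_pos _).le, ← Real.exp_add, Finset.sum_range_succ]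
          congr 2
          rw [hA]
          ring
        simp only [e]
        rw [lintegral_const_mul' _ _ ENNReal.ofReal_ne_top,
          ← ofReal_integral_eq_lintegral_ofReal (hs.integrable_exp_mul (r * b))
            (ae_of_all _ fun _ => (Real.exp_pos _).le),
          ← ENNReal.ofReal_mul (Real.exp_pos _).le]
        refine ENNReal.ofReal_le_ofReal ?_
        have hm := hs.mgf_le (r * b)
        rw [mgf] at hm
        calc _ ≤ Real.exp (A - (σ : ℝ) ^ 2 * r ^ 2 / 2 * b ^ 2)
              * Real.exp ((σ ^ 2 : ℝ≥0) * (r * b) ^ 2 / 2) := by gcongr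
          _ = Real.exp A := by
            rw [← Real.exp_add]
            congr 1
            push_cast
            ring
      · simp only [hj, if_false, add_zero]
        rw [lintegral_const, measure_univ, mul_one]
    calc _ ≤ ∫⁻ _, ENNReal.ofReal (Real.exp A) ∂(π.next t H) := lintegral_mono hpull
      _ = _ := by rw [lintegral_const, measure_univ, mul_one]

/-- Weighted sums of the noise are subgaussian, although the pulls and the numbers of triggers are
chosen adaptively. -/
theorem hasSubgaussianMGF_noise [∀ i n, IsProbabilityMeasure (ν i n)] {T : ℕ} {σ : ℝ≥0}
    (hν : IsRising ν T σ) (hG : ∀ i, G i i = 1) (hG1 : ∀ i j, G i j ≤ 1) (π : Policy k)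
    {c : ℕ → ℝ} {N : ℕ} (hc : ∀ l, l ∉ Finset.Icc 1 N → c l = 0) (i : Fin k) {V : ℝ≥0}
    (hV : ∑ l ∈ Finset.Icc 1 N, c l ^ 2 ≤ V) :
    HasSubgaussianMGF (noise ν G c i) (σ ^ 2 * V) (historyLaw ν G π T) := by
  have hm := measurable_noise (t := T) ν G c i
  have hsum : ∀ m, ∑ l ∈ Finset.range m, c l ^ 2 ≤ V := by
    intro m
    refine le_trans ?_ hV
    rw [← Finset.sum_filter_add_sum_filter_not (Finset.range m) (fun l => l ∈ Finset.Icc 1 N),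
      Finset.sum_eq_zero (s := (Finset.range m).filter fun l => ¬ l ∈ Finset.Icc 1 N), add_zero]
    · refine Finset.sum_le_sum_of_subset_of_nonneg (fun l hl => (Finset.mem_filter.1 hl).2) ?_
      intros
      positivity
    · intro l hl
      rw [hc l (Finset.mem_filter.1 hl).2]
      simp
  have key : ∀ r : ℝ, ∫⁻ H, ENNReal.ofReal (Real.exp (r * noise ν G c i H)) ∂(historyLaw ν G π T)
      ≤ ENNReal.ofReal (Real.exp ((σ ^ 2 * V : ℝ≥0) * r ^ 2 / 2)) := by
    intro r
    have h1 := lintegral_exp_noise_le hν hG hG1 π c i r T le_rfl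
    calc _ ≤ ∫⁻ H, ENNReal.ofReal (Real.exp ((σ ^ 2 * V : ℝ≥0) * r ^ 2 / 2)) *
            ENNReal.ofReal (Real.exp (r * noise ν G c i H - (σ : ℝ) ^ 2 * r ^ 2 / 2 *
              ∑ l ∈ Finset.range (pulls H i + 1), c l ^ 2)) ∂(historyLaw ν G π T) := by
          refine lintegral_mono fun H => ?_
          rw [← ENNReal.ofReal_mul (Real.exp_pos _).le, ← Real.exp_add]
          refine ENNReal.ofReal_le_ofReal (Real.exp_le_exp.2 ?_)
          have := mul_le_mul_of_nonneg_left (hsum (pulls H i + 1))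
            (by positivity : 0 ≤ (σ : ℝ) ^ 2 * r ^ 2 / 2)
          push_cast
          linarith
      _ = ENNReal.ofReal (Real.exp ((σ ^ 2 * V : ℝ≥0) * r ^ 2 / 2)) * _ :=
          lintegral_const_mul' _ _ ENNReal.ofReal_ne_top
      _ ≤ _ := mul_le_of_le_one_right' h1
  have hint : ∀ r : ℝ, Integrable (fun H => Real.exp (r * noise ν G c i H))
      (historyLaw ν G π T) := by
    intro r
    refine ⟨(hm.const_mul r).exp.aestronglyMeasurable, ?_⟩
    rw [hasFiniteIntegral_iff_ofReal (ae_of_all _ fun _ => (Real.exp_pos _).le)]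
    exact (key r).trans_lt ENNReal.ofReal_lt_top
  refine ⟨hint, fun r => ?_⟩
  have h2 := key r
  rw [← ofReal_integral_eq_lintegral_ofReal (hint r) (ae_of_all _ fun _ => (Real.exp_pos _).le)]
    at h2
  exact (ENNReal.ofReal_le_ofReal_iff (Real.exp_pos _).le).1 h2

/-- Concentration of the estimator: the bonus is exceeded with probability at most `2δ`. -/
theorem measure_noise_gt_le [∀ i n, IsProbabilityMeasure (ν i n)] {T : ℕ} {σ : ℝ≥0}
    (hν : IsRising ν T σ) (hG : ∀ i, G i i = 1) (hG1 : ∀ i j, G i j ≤ 1) (π : Policy k)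
    {t N h : ℕ} (hh : 1 ≤ h) (hN : 2 * h ≤ N) (ht : N + 1 ≤ t) (i : Fin k) {δ : ℝ} (hδ : 0 < δ)
    (hδ1 : δ ≤ 1) :
    (historyLaw ν G π T).real {H | σ * ((t : ℝ) - N + h - 1) *
      Real.sqrt (10 * Real.log (1 / δ) / (h : ℝ) ^ 3) < |noise ν G (coeff t N h) i H|} ≤ 2 * δ := by
  have hh' : (0 : ℝ) < h := by exact_mod_cast hh
  have ht' : (N : ℝ) + 1 ≤ t := by exact_mod_cast ht
  set a : ℝ := (t : ℝ) - N + h - 1 with ha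
  have ha0 : 0 < a := by linarith
  set V : ℝ≥0 := ⟨5 * a ^ 2 / (h : ℝ) ^ 3, by positivity⟩ with hV
  have hsub := hasSubgaussianMGF_noise hν hG hG1 π (fun l hl => coeff_eq_zero hl) i
    (V := V) (sum_coeff_sq_le (t := t) hh hN ht)
  set X := noise ν G (coeff t N h) i with hX
  set β := σ * a * Real.sqrt (10 * Real.log (1 / δ) / (h : ℝ) ^ 3) with hβ
  have hL : 0 ≤ Real.log (1 / δ) := Real.log_nonneg (by rw [le_div_iff₀ hδ]; linarith)
  have hβ0 : 0 ≤ β := by positivity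
  rcases eq_or_ne σ 0 with hσ | hσ
  -- Without noise the subgaussian tail bound has a junk value; the deviation is almost surely `0`.
  · have h0 : X =ᵐ[historyLaw ν G π T] 0 := by
      refine HasSubgaussianMGF.ae_eq_zero_of_hasSubgaussianMGF_zero ?_
      simpa [hσ] using hsub
    have : (historyLaw ν G π T) {H | β < |X H|} = 0 := by
      refine measure_mono_null ?_ (ae_iff.1 h0)
      intro H hH hcon
      have hH' : β < |X H| := hH
      rw [hcon] at hH'
      simp only [Pi.zero_apply, abs_zero] at hH'
      linarith
    rw [measureReal_def, this]
    simpa using hδ.le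
  · have hσ' : (0 : ℝ) < σ := by positivity
    have hexp : Real.exp (-β ^ 2 / (2 * (σ ^ 2 * V : ℝ≥0))) = δ := by
      have h1 : β ^ 2 = σ ^ 2 * a ^ 2 * (10 * Real.log (1 / δ) / (h : ℝ) ^ 3) := by
        rw [hβ, mul_pow, mul_pow, Real.sq_sqrt (by positivity)]
      have h2 : ((σ ^ 2 * V : ℝ≥0) : ℝ) = σ ^ 2 * (5 * a ^ 2 / (h : ℝ) ^ 3) := by
        push_cast
        rfl
      have h3 : -β ^ 2 / (2 * (σ ^ 2 * V : ℝ≥0)) = -Real.log (1 / δ) := by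
        rw [h1, h2]
        field_simp
        ring
      rw [h3, one_div, Real.log_inv, neg_neg, Real.exp_log hδ]
    have hp := hsub.measure_ge_le hβ0
    have hn := hsub.neg.measure_ge_le hβ0
    rw [hexp] at hp hn
    have hsubset : {H | β < |X H|} ⊆ {H | β ≤ X H} ∪ {H | β ≤ (-X) H} := by
      intro H hH
      have hH' : β < |X H| := hH
      rcases le_total 0 (X H) with h0 | h0
      · rw [abs_of_nonneg h0] at hH'
        exact Or.inl hH'.le
      · rw [abs_of_nonpos h0] at hH'
        exact Or.inr hH'.le
    have := (measureReal_mono hsubset (μ := historyLaw ν G π T)).trans (measureReal_union_le _ _)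
    linarith

theorem before_castSucc (H : History k t) (p : Fin k × ℝ) (s : Fin t) :
    before (Fin.snoc (α := fun _ => Fin k × ℝ) H p : History k (t + 1)) s.castSucc
      = before H s := by
  funext τ
  exact Fin.snoc_castSucc (α := fun _ => Fin k × ℝ) p H (Fin.castLE s.2.le τ)

theorem before_last (H : History k t) (p : Fin k × ℝ) :
    before (Fin.snoc (α := fun _ => Fin k × ℝ) H p : History k (t + 1)) (Fin.last t) = H := by
  funext τ
  exact Fin.snoc_castSucc (α := fun _ => Fin k × ℝ) p H τ

theorem measurable_before (s : Fin t) : Measurable fun H : History k t => before H s :=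
  measurable_pi_iff.2 fun _ => measurable_pi_apply _

/-- Almost surely, every arm pulled has positive conditional probability. -/
theorem ae_next_ne_zero [∀ i n, IsProbabilityMeasure (ν i n)] (π : Policy k) (t : ℕ) :
    ∀ᵐ H ∂(historyLaw ν G π t), ∀ s : Fin t, π.next s (before H s) {(H s).1} ≠ 0 := by
  have hmeas : ∀ t : ℕ, MeasurableSet {H : History k t |
      ∀ s : Fin t, π.next s (before H s) {(H s).1} ≠ 0} := by
    intro t
    rw [Set.ofPred_forall]
    refine MeasurableSet.iInter fun s => ?_
    have : {H : History k t | π.next s (before H s) {(H s).1} ≠ 0}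
        = ⋃ i, {H : History k t | (H s).1 = i} ∩ {H | π.next s (before H s) {i} ≠ 0} := by
      ext H
      simp
    rw [this]
    refine MeasurableSet.iUnion fun i => MeasurableSet.inter ?_ ?_
    · exact (show Measurable fun H : History k t => (H s).1 by fun_prop)
        (measurableSet_singleton i)
    · have h1 : Measurable fun H : History k t => π.next s (before H s) {i} :=
        ((π.next s).measurable_coe (measurableSet_singleton i)).comp (measurable_before s)
      exact h1 (measurableSet_singleton 0).compl
  induction t with
  | zero => exact ae_of_all _ fun H s => s.elim0
  | succ t ih =>
    rw [historyLaw, ae_map_iff measurable_snoc.aemeasurable (hmeas _)]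
    refine Measure.ae_compProd_of_ae_ae (measurable_snoc (hmeas _)) ?_
    filter_upwards [ih] with H hH
    refine Kernel.ae_compProd_of_ae_ae
      ((measurable_snoc.comp (by fun_prop : Measurable fun b : Fin k × ℝ => (H, b))) (hmeas _)) ?_
    have hsupp : ∀ᵐ i ∂(π.next t H), π.next t H {i} ≠ 0 := by
      rw [ae_iff]
      have : {i | ¬ π.next t H {i} ≠ 0} = ⋃ i ∈ {i | ¬ π.next t H {i} ≠ 0}, {i} :=
        (Set.biUnion_of_singleton _).symm
      rw [this, measure_biUnion_null_iff (Set.to_countable _)]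
      intro i hi
      simpa using hi
    filter_upwards [hsupp] with i hi
    refine ae_of_all _ fun x s => ?_
    refine Fin.lastCases ?_ (fun s => ?_) s
    · rw [before_last]
      simpa using hi
    · rw [before_castSucc]
      simpa using hH s

end Noise

/-! ### Summing the cost of the pulls -/

section Cost

variable {k : ℕ} (ν : Fin k → ℕ → Measure ℝ) (𝒞 : Finpartition (Finset.univ : Finset (Fin k)))
  (σ : ℝ≥0) (ε α : ℝ) (T : ℕ)

/-- The summands of `totalIncrement`, set to `0` outside the range in which the rewards are known
to be rising, so as to be an antitone sequence. -/
noncomputable def maxIncrement (q : ℝ) (n : ℕ) : ℝ :=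
  if 1 ≤ n ∧ n + 1 ≤ T then ⨆ i : Fin k, increment ν i n ^ q else 0

/-- The factor by which the bias of arm `i` exceeds that of a rested arm: within a window of
`⌊εN⌋` pulls, an arm of a larger clique may be triggered up to `T` times. -/
noncomputable def slopeFactor (i : Fin k) (N : ℕ) : ℝ :=
  if (𝒞.part i).card = 1 then 1 else T / ⌊ε * N⌋₊

/-- A bound on the loss incurred by pulling arm `i` after `N` earlier pulls, if all the estimators
are within their bonuses. -/
noncomputable def costBound (i : Fin k) (N : ℕ) : ℝ :=
  if ⌊ε * N⌋₊ = 0 then 1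
  else min 1 (2 * (σ * T * Real.sqrt (10 * (α * Real.log T) / (⌊ε * N⌋₊ : ℝ) ^ 3)))
    + min 1 (T * increment ν i (oldest ε N) * slopeFactor 𝒞 ε T i N)

variable {ν σ T}

theorem IsRising.maxIncrement_nonneg (hν : IsRising ν T σ) (q : ℝ) (n : ℕ) :
    0 ≤ maxIncrement ν T q n := by
  unfold maxIncrement
  split_ifs with h
  · exact Real.iSup_nonneg fun i => Real.rpow_nonneg (hν.nondecreasing i n h.1 h.2) _
  · exact le_rfl

theorem IsRising.maxIncrement_anti (hν : IsRising ν T σ) {q : ℝ} (hq : 0 ≤ q) (a b : ℕ)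
    (ha : 1 ≤ a) (hab : a ≤ b) : maxIncrement ν T q b ≤ maxIncrement ν T q a := by
  by_cases hb : 1 ≤ b ∧ b + 1 ≤ T
  · rw [maxIncrement, maxIncrement, if_pos hb, if_pos ⟨ha, by omega⟩]
    refine ciSup_mono (Set.finite_range _).bddAbove fun i => ?_
    exact Real.rpow_le_rpow (hν.nondecreasing i b hb.1 hb.2) (hν.increment_anti i ha hab hb.2) hq
  · have := hν.maxIncrement_nonneg q a
    rw [maxIncrement, if_neg hb]
    exact this

theorem IsRising.increment_rpow_le (hν : IsRising ν T σ) (q : ℝ) (i : Fin k) (n : ℕ)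
    (h1 : 1 ≤ n) (h2 : n + 1 ≤ T) :
    0 ≤ increment ν i n ∧ increment ν i n ^ q ≤ maxIncrement ν T q n := by
  refine ⟨hν.nondecreasing i n h1 h2, ?_⟩
  rw [maxIncrement, if_pos ⟨h1, h2⟩]
  exact le_ciSup (f := fun i => increment ν i n ^ q) (Set.finite_range _).bddAbove i

theorem sum_maxIncrement (q : ℝ) {M : ℕ} (hM : M ≤ T) :
    ∑ n ∈ Finset.Icc 1 (M - 1), maxIncrement ν T q n = totalIncrement ν M q := by
  refine Finset.sum_congr rfl fun n hn => ?_
  rw [Finset.mem_Icc] at hn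
  rw [maxIncrement, if_pos (by omega)]

theorem ceil_div_le {m : ℕ} (hm : 1 ≤ m) : ⌈(T : ℝ) / m⌉₊ ≤ T := by
  refine Nat.ceil_le.2 (div_le_self (by positivity) ?_)
  exact_mod_cast hm

theorem le_mul_ceil_div {m : ℕ} (hm : 1 ≤ m) : T ≤ m * ⌈(T : ℝ) / m⌉₊ := by
  have hm' : (0 : ℝ) < m := by exact_mod_cast hm
  have := Nat.le_ceil ((T : ℝ) / m)
  rw [div_le_iff₀ hm'] at this
  have h2 : (T : ℝ) ≤ ((m * ⌈(T : ℝ) / m⌉₊ : ℕ) : ℝ) := by push_cast; linarith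
  exact_mod_cast h2

theorem IsRising.totalIncrement_nonneg (hν : IsRising ν T σ) (q : ℝ) {m : ℕ} (hm : 1 ≤ m) :
    0 ≤ totalIncrement ν ⌈(T : ℝ) / m⌉₊ q := by
  rw [← sum_maxIncrement q (ceil_div_le hm)]
  exact Finset.sum_nonneg fun n _ => hν.maxIncrement_nonneg q n

variable (T) in
theorem sum_noise_cost_le (hε : 0 < ε) (hα : 0 ≤ α) {N : ℕ} (hN : N ≤ T) :
    ∑ n ∈ Finset.range N, (if ⌊ε * n⌋₊ = 0 then 0 else
        min 1 (2 * (σ * T * Real.sqrt (10 * (α * Real.log T) / (⌊ε * n⌋₊ : ℝ) ^ 3))))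
      ≤ 4 / ε * (1 + 10 * α) * (1 + Real.log T) ^ 2 * (σ * T : ℝ) ^ (2 / 3 : ℝ) := by
  have hlog : 0 ≤ Real.log T := Real.log_natCast_nonneg T
  have h1 : ∀ n ∈ Finset.range N, (if ⌊ε * n⌋₊ = 0 then 0 else
        min 1 (2 * (σ * T * Real.sqrt (10 * (α * Real.log T) / (⌊ε * n⌋₊ : ℝ) ^ 3))))
      ≤ 4 / ε * (1 + 10 * α) * (1 + Real.log T) * (σ * T : ℝ) ^ (2 / 3 : ℝ) * (1 / (n : ℝ)) := by
    intro n _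
    split_ifs with h
    · positivity
    · exact min_one_bonus_le hε hα (by positivity) hlog h
  have h2 : ∑ n ∈ Finset.range N, (1 / (n : ℝ)) ≤ 1 + Real.log T := by
    calc ∑ n ∈ Finset.range N, (1 / (n : ℝ)) ≤ ∑ n ∈ Finset.range (T + 1), (1 / (n : ℝ)) := by
          refine Finset.sum_le_sum_of_subset_of_nonneg ?_ fun _ _ _ => by positivity
          exact Finset.range_subset_range.2 (by omega)
      _ = (harmonic T : ℝ) := by
          rw [Finset.sum_range_succ', harmonic]
          simp
      _ ≤ _ := harmonic_le_one_add_log T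
  refine (Finset.sum_le_sum h1).trans ?_
  rw [← Finset.mul_sum]
  calc _ ≤ 4 / ε * (1 + 10 * α) * (1 + Real.log T) * (σ * T : ℝ) ^ (2 / 3 : ℝ)
        * (1 + Real.log T) := by gcongr
    _ = _ := by ring

theorem sum_initial_cost_le (hε : 0 < ε) (N : ℕ) :
    ∑ n ∈ Finset.range N, (if ⌊ε * n⌋₊ = 0 then (1 : ℝ) else 0) ≤ 1 / ε + 1 := by
  rw [← Finset.sum_filter, Finset.sum_const, nsmul_eq_mul, mul_one]
  have hsub : (Finset.range N).filter (fun n : ℕ => ⌊ε * n⌋₊ = 0) ⊆ Finset.range ⌈1 / ε⌉₊ := by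
    intro n hn
    rw [Finset.mem_filter, Nat.floor_eq_zero] at hn
    refine Finset.mem_range.2 (Nat.lt_ceil.2 ?_)
    rw [lt_div_iff₀ hε]
    linarith [hn.2]
  have h2 := Finset.card_le_card hsub
  rw [Finset.card_range] at h2
  have h3 : (((Finset.range N).filter (fun n : ℕ => ⌊ε * n⌋₊ = 0)).card : ℝ) ≤ ⌈1 / ε⌉₊ := by
    exact_mod_cast h2
  linarith [Nat.ceil_lt_add_one (by positivity : 0 ≤ 1 / ε)]

/-- Total bias of all the arms: rested for the singleton cliques, restless for the others. -/
theorem sum_bias_cost_le (hν : IsRising ν T σ) (hε : 0 < ε) (hε' : ε < 1 / 2) {q : ℝ}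
    (hq : 0 ≤ q) (hq' : q ≤ 1) (N : Fin k → ℕ) (hN : ∑ i, N i ≤ T) :
    ∑ i, ∑ n ∈ Finset.range (N i), (if ⌊ε * n⌋₊ = 0 then 0 else
        min 1 (T * increment ν i (oldest ε n) * slopeFactor 𝒞 ε T i n))
      ≤ k + (1 + 6 / ε * ⌈1 / (1 - 2 * ε)⌉₊) * biasTerm ν 𝒞 T q := by
  set D : ℝ := (⌈1 / (1 - 2 * ε)⌉₊ : ℝ) with hD
  have hD0 : 0 ≤ D := by positivity
  set b : Fin k → ℝ := fun i => ∑ n ∈ Finset.range (N i), (if ⌊ε * n⌋₊ = 0 then 0 else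
        min 1 (T * increment ν i (oldest ε n) * slopeFactor 𝒞 ε T i n)) with hb
  set S := 𝒞.parts.filter fun C => C.card = 1 with hS
  set R := 𝒞.parts.filter fun C => 1 < C.card with hR
  have hdisj : (𝒞.parts : Set (Finset (Fin k))).PairwiseDisjoint id := 𝒞.disjoint
  have hpos : ∀ C ∈ 𝒞.parts, 1 ≤ C.card := fun C hC => (𝒞.nonempty_of_mem_parts hC).card_pos
  have hR' : 𝒞.parts.filter (fun C => ¬ C.card = 1) = R := by
    refine Finset.filter_congr fun C hC => ?_
    have := hpos C hC
    omega
  have hsplit : ∀ f : Finset (Fin k) → ℝ,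
      ∑ C ∈ 𝒞.parts, f C = ∑ C ∈ S, f C + ∑ C ∈ R, f C := by
    intro f
    rw [← Finset.sum_filter_add_sum_filter_not 𝒞.parts (fun C => C.card = 1), hR']
  have hsum : ∑ i, b i = ∑ C ∈ 𝒞.parts, ∑ i ∈ C, b i := by
    have := Finset.sum_biUnion (f := b) hdisj
    rw [𝒞.biUnion_parts] at this
    exact this
  have hSdisj : (S : Set (Finset (Fin k))).PairwiseDisjoint id :=
    hdisj.subset (by exact_mod_cast Finset.filter_subset _ _)
  have hScard : (S.biUnion id).card = numSingletons 𝒞 := by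
    have h1 : ∑ C ∈ S, (id C : Finset (Fin k)).card = ∑ C ∈ S, 1 :=
      Finset.sum_congr rfl fun C hC => (Finset.mem_filter.1 hC).2
    rw [Finset.card_biUnion hSdisj, h1]
    simp [numSingletons, hS]
  have hsub : ∀ s : Finset (Fin k), ∑ i ∈ s, N i ≤ T := fun s =>
    (Finset.sum_le_sum_of_subset (Finset.subset_univ s)).trans hN
  have hrest : ∑ C ∈ S, ∑ i ∈ C, b i ≤ numSingletons 𝒞 + 3 * D * ((numSingletons 𝒞 : ℝ) *
      (T : ℝ) ^ q * totalIncrement ν ⌈(T : ℝ) / (numSingletons 𝒞 : ℝ)⌉₊ q) := by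
    have e : ∑ C ∈ S, ∑ i ∈ C, b i = ∑ i ∈ S.biUnion id, b i :=
      (Finset.sum_biUnion hSdisj).symm
    rw [e]
    rcases Nat.eq_zero_or_pos (numSingletons 𝒞) with hm | hm
    -- Without singletons `⌈T / 0⌉ = 0` is a junk value, multiplied by `0`.
    · rw [hm] at hScard
      rw [Finset.card_eq_zero.1 hScard, hm]
      simp
    · have := sum_rested_bias_le hε hε' hq hq' (hν.maxIncrement_nonneg q)
        (hν.maxIncrement_anti hq) (hν.increment_rpow_le q) (S.biUnion id) N
        (M := ⌈(T : ℝ) / (numSingletons 𝒞 : ℝ)⌉₊) (hsub _)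
        (by rw [hScard]; exact le_mul_ceil_div hm)
      rw [sum_maxIncrement q (ceil_div_le hm), hScard] at this
      refine le_trans (le_of_eq ?_) this
      refine Finset.sum_congr rfl fun i hi => Finset.sum_congr rfl fun n _ => ?_
      obtain ⟨C, hC, hiC⟩ := Finset.mem_biUnion.1 hi
      rw [hS, Finset.mem_filter] at hC
      have hf : slopeFactor 𝒞 ε T i n = 1 := by
        rw [slopeFactor, 𝒞.part_eq_of_mem hC.1 hiC, if_pos hC.2]
      rw [hf, mul_one]
  have hclique : ∀ C ∈ R, ∑ i ∈ C, b i ≤ C.card + (1 + 6 / ε * D) * (C.card *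
      ((T : ℝ) ^ (2 * q / (1 + q)) *
        totalIncrement ν ⌈(T : ℝ) / (C.card : ℝ)⌉₊ q ^ (1 / (1 + q)))) := by
    intro C hC
    rw [hR, Finset.mem_filter] at hC
    have := sum_restless_bias_le hε hε' hq hq' (hν.maxIncrement_nonneg q)
        (hν.maxIncrement_anti hq) (hν.increment_rpow_le q) C N
        (M := ⌈(T : ℝ) / (C.card : ℝ)⌉₊) (hsub _) (le_mul_ceil_div hC.2.le)
    rw [sum_maxIncrement q (ceil_div_le hC.2.le)] at this
    refine le_trans (le_of_eq ?_) this
    refine Finset.sum_congr rfl fun i hi => Finset.sum_congr rfl fun n _ => ?_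
    have hf : slopeFactor 𝒞 ε T i n = T / ⌊ε * n⌋₊ := by
      rw [slopeFactor, 𝒞.part_eq_of_mem hC.1 hi, if_neg hC.2.ne']
    rw [hf]
  have hcard : (numSingletons 𝒞 : ℝ) + ∑ C ∈ R, (C.card : ℝ) = k := by
    have h1 : (numSingletons 𝒞 : ℝ) = ∑ C ∈ S, (C.card : ℝ) := by
      rw [← hScard, Finset.card_biUnion hSdisj]
      push_cast
      rfl
    rw [h1, ← hsplit fun C => (C.card : ℝ)]
    have := 𝒞.sum_card_parts
    rw [Finset.card_univ, Fintype.card_fin] at this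
    exact_mod_cast this
  have hnn : 0 ≤ (numSingletons 𝒞 : ℝ) * (T : ℝ) ^ q *
      totalIncrement ν ⌈(T : ℝ) / (numSingletons 𝒞 : ℝ)⌉₊ q := by
    rcases Nat.eq_zero_or_pos (numSingletons 𝒞) with hm | hm
    · rw [hm]; simp
    · have := hν.totalIncrement_nonneg q hm
      positivity
  have h3D : 3 * D ≤ 1 + 6 / ε * D := by
    have : 3 ≤ 6 / ε := by rw [le_div_iff₀ hε]; linarith
    nlinarith
  rw [hsum, hsplit]
  calc _ ≤ (numSingletons 𝒞 + 3 * D * ((numSingletons 𝒞 : ℝ) *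
        (T : ℝ) ^ q * totalIncrement ν ⌈(T : ℝ) / (numSingletons 𝒞 : ℝ)⌉₊ q)) +
        ∑ C ∈ R, (C.card + (1 + 6 / ε * D) * (C.card * ((T : ℝ) ^ (2 * q / (1 + q)) *
          totalIncrement ν ⌈(T : ℝ) / (C.card : ℝ)⌉₊ q ^ (1 / (1 + q))))) :=
        add_le_add hrest (Finset.sum_le_sum hclique)
    _ ≤ (numSingletons 𝒞 + (1 + 6 / ε * D) * ((numSingletons 𝒞 : ℝ) *
        (T : ℝ) ^ q * totalIncrement ν ⌈(T : ℝ) / (numSingletons 𝒞 : ℝ)⌉₊ q)) +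
        ∑ C ∈ R, (C.card + (1 + 6 / ε * D) * (C.card * ((T : ℝ) ^ (2 * q / (1 + q)) *
          totalIncrement ν ⌈(T : ℝ) / (C.card : ℝ)⌉₊ q ^ (1 / (1 + q))))) := by gcongr
    _ = k + (1 + 6 / ε * D) * biasTerm ν 𝒞 T q := by
        rw [Finset.sum_add_distrib, ← hcard, biasTerm, mul_add, Finset.mul_sum, Finset.mul_sum]
        have : ∀ C : Finset (Fin k), (1 + 6 / ε * D) * (C.card * ((T : ℝ) ^ (2 * q / (1 + q)) *
            totalIncrement ν ⌈(T : ℝ) / (C.card : ℝ)⌉₊ q ^ (1 / (1 + q))))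
            = (1 + 6 / ε * D) * ((T : ℝ) ^ (2 * q / (1 + q)) * (C.card *
            totalIncrement ν ⌈(T : ℝ) / (C.card : ℝ)⌉₊ q ^ (1 / (1 + q)))) := fun C => by ring
        simp only [this]
        ring

theorem biasTerm_nonneg (hν : IsRising ν T σ) (q : ℝ) : 0 ≤ biasTerm ν 𝒞 T q := by
  refine add_nonneg ?_ (mul_nonneg (by positivity) (Finset.sum_nonneg fun C hC => ?_))
  · rcases Nat.eq_zero_or_pos (numSingletons 𝒞) with hm | hm
    · rw [hm]; simp
    · have := hν.totalIncrement_nonneg q hm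
      positivity
  · have := hν.totalIncrement_nonneg q (Finset.mem_filter.1 hC).2.le
    positivity

theorem sum_costBound_le (hν : IsRising ν T σ) (hε : 0 < ε) (hε' : ε < 1 / 2) (hα : 0 ≤ α) {q : ℝ}
    (hq : 0 ≤ q) (hq' : q ≤ 1) (N : Fin k → ℕ) (hN : ∑ i, N i ≤ T) :
    ∑ i, ∑ n ∈ Finset.range (N i), costBound ν 𝒞 σ ε α T i n
      ≤ (3 + 1 / ε + 4 / ε * (1 + 10 * α) + 6 / ε * ⌈1 / (1 - 2 * ε)⌉₊) * (1 + Real.log T) ^ 2 *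
        (k + k * (σ * T : ℝ) ^ (2 / 3 : ℝ) + biasTerm ν 𝒞 T q) := by
  have hB := biasTerm_nonneg 𝒞 hν q
  have hlog : 0 ≤ Real.log T := Real.log_natCast_nonneg T
  have hlog2 : 1 ≤ (1 + Real.log T) ^ 2 := one_le_pow₀ (by linarith)
  have hNi : ∀ i, N i ≤ T := fun i =>
    (Finset.single_le_sum (fun _ _ => Nat.zero_le _) (Finset.mem_univ i)).trans hN
  have e : ∀ i n, costBound ν 𝒞 σ ε α T i n = (if ⌊ε * n⌋₊ = 0 then (1 : ℝ) else 0) +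
      (if ⌊ε * n⌋₊ = 0 then 0 else
        min 1 (2 * (σ * T * Real.sqrt (10 * (α * Real.log T) / (⌊ε * n⌋₊ : ℝ) ^ 3)))) +
      (if ⌊ε * n⌋₊ = 0 then 0 else
        min 1 (T * increment ν i (oldest ε n) * slopeFactor 𝒞 ε T i n)) := by
    intro i n
    unfold costBound
    split_ifs <;> ring
  simp only [e, Finset.sum_add_distrib]
  have h1 := Finset.sum_le_card_nsmul (Finset.univ : Finset (Fin k)) _ _
    fun i _ => sum_initial_cost_le ε hε (N i)
  have h2 := Finset.sum_le_card_nsmul (Finset.univ : Finset (Fin k)) _ _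
    fun i _ => sum_noise_cost_le (σ := σ) ε α T hε hα (hNi i)
  have h3 := sum_bias_cost_le 𝒞 ε hν hε hε' hq hq' N hN
  rw [Finset.card_univ, Fintype.card_fin, nsmul_eq_mul] at h1 h2
  refine (add_le_add (add_le_add h1 h2) h3).trans ?_
  set D : ℝ := (⌈1 / (1 - 2 * ε)⌉₊ : ℝ) with hD
  have hD0 : 0 ≤ D := by positivity
  set B := biasTerm ν 𝒞 T q
  set y := (σ * T : ℝ) ^ (2 / 3 : ℝ)
  have hy : 0 ≤ y := by positivity
  set L := (1 + Real.log T) ^ 2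
  set A := 4 / ε * (1 + 10 * α)
  have hA : 0 ≤ A := by positivity
  set E := 6 / ε * D
  have hE : 0 ≤ E := by positivity
  set I := 1 / ε
  have hI : 0 ≤ I := by positivity
  have hk : (0 : ℝ) ≤ k := by positivity
  have hX : (k : ℝ) * (I + 1) + k + (1 + E) * B
      ≤ L * (k * (I + 1) + k + (1 + E) * B) := by
    have : 0 ≤ (k : ℝ) * (I + 1) + k + (1 + E) * B := by positivity
    nlinarith
  have hrem : 0 ≤ L * (k * (1 + A + E) + k * y * (3 + I + E) + B * (2 + I + A)) := by positivity
  nlinarith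

end Cost

/-! ### Regret -/

section Regret

variable {k : ℕ} {ν : Fin k → ℕ → Measure ℝ} {𝒞 : Finpartition (Finset.univ : Finset (Fin k))}
  {G : Matrix (Fin k) (Fin k) ℕ} {σ : ℝ≥0} {ε α : ℝ} {T : ℕ} {π : Policy k}

/-- The event that, after `N` pulls of arm `i`, the estimator of that arm in the round with index
`s` deviates from its noiseless version by more than the bonus. -/
def deviation (ν : Fin k → ℕ → Measure ℝ) (G : Matrix (Fin k) (Fin k) ℕ) (σ : ℝ≥0) (ε : ℝ)
    (δ : ℕ → ℝ) (s : Fin T) (i : Fin k) (N : ℕ) : Set (History k T) :=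
  {H | ⌊ε * N⌋₊ ≠ 0 ∧ σ * (((s + 1 : ℕ) : ℝ) - N + ⌊ε * N⌋₊ - 1) *
    Real.sqrt (10 * Real.log (1 / δ (s + 1)) / (⌊ε * N⌋₊ : ℝ) ^ 3)
      < |noise ν G (coeff (s + 1) N ⌊ε * N⌋₊) i H|}

theorem measurableSet_deviation (δ : ℕ → ℝ) (s : Fin T) (i : Fin k) (N : ℕ) :
    MeasurableSet (deviation ν G σ ε δ s i N) := by
  refine MeasurableSet.inter (MeasurableSet.const _) ?_
  exact measurableSet_lt measurable_const
    (continuous_abs.measurable.comp (measurable_noise ν G _ i))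

theorem measure_deviation_le [∀ i n, IsProbabilityMeasure (ν i n)] (hν : IsRising ν T σ)
    (hG : IsBlockDiagonal G 𝒞) (π : Policy k) (hε : 0 < ε) (hε' : ε < 1 / 2) {δ : ℕ → ℝ}
    (s : Fin T) (hδ : 0 < δ (s + 1)) (hδ1 : δ (s + 1) ≤ 1) (i : Fin k) {N : ℕ} (hN : N ≤ s) :
    (historyLaw ν G π T).real (deviation ν G σ ε δ s i N) ≤ 2 * δ (s + 1) := by
  by_cases h : ⌊ε * N⌋₊ = 0
  · have : deviation ν G σ ε δ s i N = (∅ : Set (History k T)) := by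
      ext H
      simp [deviation, h]
    rw [this]
    simpa using hδ.le
  · refine le_trans (measureReal_mono fun H hH => hH.2) ?_
    exact measure_noise_gt_le hν hG.diag hG.le_one π (by omega) (two_mul_floor_le hε hε' N)
      (by omega) i hδ hδ1

theorem one_le_triggers (hG : IsBlockDiagonal G 𝒞) (H : History k T) (s : Fin T) :
    1 ≤ triggers G H s (H s).1 :=
  (Finset.mem_Icc.1 (rank_mem_Icc H rfl)).1.trans (rank_le_triggers hG.diag H s _)

theorem reward_mem_Icc (hν : IsRising ν T σ) (hG : IsBlockDiagonal G 𝒞) (H : History k T)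
    (s : Fin T) : mean ν (H s).1 (triggers G H s (H s).1) ∈ Set.Icc (0 : ℝ) 1 :=
  hν.mean_mem _ _ (one_le_triggers hG H s) ((triggers_le hG.le_one H s _).trans s.2)

/-- No policy earns more in a round than the best arm would, had it been triggered in every
round. -/
theorem reward_le (hν : IsRising ν T σ) (hG : IsBlockDiagonal G 𝒞) (H : History k T)
    (s : Fin T) :
    mean ν (H s).1 (triggers G H s (H s).1) ≤ ⨆ i, mean ν i (s + 1) :=
  (hν.mean_mono _ (one_le_triggers hG H s) (triggers_le hG.le_one H s _) s.2).trans
    (le_ciSup (f := fun i => mean ν i (s + 1)) (Set.finite_range _).bddAbove _)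

theorem min_one_add_le {a b : ℝ} (ha : 0 ≤ a) (hb : 0 ≤ b) :
    min 1 (a + b) ≤ min 1 a + min 1 b := by
  rcases le_total 1 a with h | h
  · rw [min_eq_left h]
    linarith [min_le_left 1 (a + b), le_min zero_le_one hb]
  · rcases le_total 1 b with h' | h'
    · rw [min_eq_left h']
      linarith [min_le_left 1 (a + b), le_min zero_le_one ha]
    · rw [min_eq_right h, min_eq_right h']
      exact min_le_right _ _

theorem slopeFactor_nonneg (i : Fin k) (N : ℕ) : 0 ≤ slopeFactor 𝒞 ε T i N := by
  unfold slopeFactor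
  split_ifs <;> positivity

theorem costBound_nonneg (hν : IsRising ν T σ) (hε : 0 < ε) (hε' : ε < 1 / 2) (i : Fin k) {N : ℕ}
    (hN : N < T) : 0 ≤ costBound ν 𝒞 σ ε α T i N := by
  unfold costBound
  split_ifs with h
  · exact zero_le_one
  · have h1 := hν.nondecreasing i (oldest ε N) (by simp [oldest])
      (by have := oldest_lt hε hε' h; omega)
    have h2 := slopeFactor_nonneg (𝒞 := 𝒞) (ε := ε) (T := T) i N
    positivity

theorem extrapolate_le_slopeFactor (hν : IsRising ν T σ) (hG : IsBlockDiagonal G 𝒞)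
    (hε : 0 < ε) (hε' : ε < 1 / 2) (H : History k T) (s : Fin T) (i : Fin k)
    (h : ⌊ε * pulls (before H s) i⌋₊ ≠ 0) :
    extrapolate (meanObs ν G H i) (s + 1) (pulls (before H s) i) ⌊ε * pulls (before H s) i⌋₊ ≤
      mean ν i (triggers G H s i) + T * increment ν i (oldest ε (pulls (before H s) i)) *
        slopeFactor 𝒞 ε T i (pulls (before H s) i) := by
  have hmem := 𝒞.mem_part (Finset.mem_univ i)
  have hpart := (𝒞.part_mem (a := i)).2 (Finset.mem_univ i)
  unfold slopeFactor
  split_ifs with h1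
  · have := extrapolate_meanObs_le H s i hν hG.diag hG.le_one hε hε' h
      (Or.inr ⟨rfl, hG.eq_ite hpart hmem h1⟩)
    have hpos : (⌊ε * pulls (before H s) i⌋₊ : ℝ) ≠ 0 := by exact_mod_cast h
    rwa [div_self hpos] at this
  · exact extrapolate_meanObs_le H s i hν hG.diag hG.le_one hε hε' h (Or.inl rfl)

/-- The loss of a round, when the arm pulled has maximal index. -/
theorem loss_le [Nonempty (Fin k)] (hν : IsRising ν T σ) (hG : IsBlockDiagonal G 𝒞) (hε : 0 < ε)
    (hε' : ε < 1 / 2) (hα : 0 ≤ α) (H : History k T) (s : Fin T)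
    (hmax : ∀ j, index σ ε (fun t => (t : ℝ) ^ (-α)) (before H s) j
      ≤ index σ ε (fun t => (t : ℝ) ^ (-α)) (before H s) (H s).1) :
    (⨆ i, mean ν i (s + 1)) - mean ν (H s).1 (triggers G H s (H s).1)
      ≤ costBound ν 𝒞 σ ε α T (H s).1 (pulls (before H s) (H s).1)
        + ∑ i, ∑ N ∈ Finset.range (s + 1),
            (deviation ν G σ ε (fun t => (t : ℝ) ^ (-α)) s i N).indicator 1 H := by
  set δ : ℕ → ℝ := fun t => (t : ℝ) ^ (-α) with hδ
  set a := (H s).1 with ha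
  have hsT := s.2
  have hone : (⨆ i, mean ν i (s + 1)) - mean ν a (triggers G H s a) ≤ 1 := by
    have h1 : ⨆ i, mean ν i (s + 1) ≤ 1 := ciSup_le fun i => (hν.mean_mem i _ (by omega) s.2).2
    have h2 := (reward_mem_Icc hν hG H s).1
    linarith
  have hind : ∀ i N, 0 ≤ (deviation ν G σ ε δ s i N).indicator (1 : History k T → ℝ) H :=
    fun i N => Set.indicator_nonneg (fun _ _ => zero_le_one) H
  have hsum : 0 ≤ ∑ i, ∑ N ∈ Finset.range (s + 1),
      (deviation ν G σ ε δ s i N).indicator (1 : History k T → ℝ) H :=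
    Finset.sum_nonneg fun i _ => Finset.sum_nonneg fun N _ => hind i N
  have hcost := costBound_nonneg (𝒞 := 𝒞) (α := α) hν hε hε' a
    (lt_of_le_of_lt (pulls_before_le H s a) hsT)
  by_cases hwin : ⌊ε * pulls (before H s) a⌋₊ = 0
  · have : costBound ν 𝒞 σ ε α T a (pulls (before H s) a) = 1 := by
      rw [costBound, if_pos hwin]
    linarith
  by_cases hdev : ∃ i, H ∈ deviation ν G σ ε δ s i (pulls (before H s) i)
  · obtain ⟨i, hi⟩ := hdev
    have h1 : (1 : ℝ) ≤ ∑ i, ∑ N ∈ Finset.range (s + 1),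
        (deviation ν G σ ε δ s i N).indicator (1 : History k T → ℝ) H := by
      calc (1 : ℝ) = (deviation ν G σ ε δ s i (pulls (before H s) i)).indicator
            (1 : History k T → ℝ) H := by rw [Set.indicator_of_mem hi]; rfl
        _ ≤ ∑ N ∈ Finset.range (s + 1),
            (deviation ν G σ ε δ s i N).indicator (1 : History k T → ℝ) H :=
          Finset.single_le_sum
            (f := fun N => (deviation ν G σ ε δ s i N).indicator (1 : History k T → ℝ) H)
            (fun N _ => hind i N)
            (Finset.mem_range.2 (Nat.lt_succ_of_le (pulls_before_le H s i)))
        _ ≤ _ := Finset.single_le_sum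
            (f := fun i => ∑ N ∈ Finset.range (s + 1),
              (deviation ν G σ ε δ s i N).indicator (1 : History k T → ℝ) H)
            (fun i _ => Finset.sum_nonneg fun N _ => hind i N) (Finset.mem_univ i)
    linarith
  -- No estimator is off by more than its bonus: compare the arm pulled with the best arm.
  · push Not at hdev
    obtain ⟨j, hj⟩ := exists_eq_ciSup_of_finite (f := fun i => mean ν i (s + 1))
    have hconc : ∀ i, ⌊ε * pulls (before H s) i⌋₊ ≠ 0 →
        |estimator (before H s) i ⌊ε * pulls (before H s) i⌋₊
          - extrapolate (meanObs ν G H i) (s + 1) (pulls (before H s) i)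
              ⌊ε * pulls (before H s) i⌋₊|
          ≤ bonus σ (before H s) i ⌊ε * pulls (before H s) i⌋₊ (δ (s + 1)) := by
      intro i hi
      rw [extrapolate_obs_sub ν G H s i (by omega) (two_mul_floor_le hε hε' _)]
      by_contra hcon
      exact hdev i ⟨hi, not_le.1 hcon⟩
    have hjmax := hmax j
    -- The arm pulled has a finite index, so all arms have one.
    have hwinj : ⌊ε * pulls (before H s) j⌋₊ ≠ 0 := by
      intro h0
      rw [index, if_pos h0, index, if_neg hwin] at hjmax
      exact absurd hjmax (not_le.2 (EReal.coe_lt_top _))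
    rw [index, if_neg hwinj, index, if_neg hwin, EReal.coe_le_coe_iff] at hjmax
    have hopt := mean_le_extrapolate_meanObs H s j hν hG.diag hG.le_one hε hε' hwinj
    have hbias := extrapolate_le_slopeFactor hν hG hε hε' H s a hwin
    have h1 := abs_le.1 (hconc j hwinj)
    have h2 := abs_le.1 (hconc a hwin)
    set N := pulls (before H s) a with hN
    set w := ⌊ε * N⌋₊ with hw
    have hN1 := one_le_of_floor_ne_zero hwin
    have hbonus : bonus σ (before H s) a w (δ (s + 1))
        ≤ σ * T * Real.sqrt (10 * (α * Real.log T) / (w : ℝ) ^ 3) := by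
      have hs1 : (0 : ℝ) < ((s + 1 : ℕ) : ℝ) := by positivity
      have hsT' : ((s + 1 : ℕ) : ℝ) ≤ T := by exact_mod_cast hsT
      have hlog : Real.log (1 / δ (s + 1)) ≤ α * Real.log T := by
        rw [hδ, one_div, Real.log_inv, Real.log_rpow hs1, neg_mul, neg_neg]
        gcongr
      have hwN : (w : ℝ) ≤ N := by
        have := two_mul_floor_le hε hε' N
        exact_mod_cast (by omega : w ≤ N)
      unfold bonus
      rw [← hN]
      have : ((s + 1 : ℕ) : ℝ) - N + w - 1 ≤ T := by linarith
      gcongr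
    have hbias0 : 0 ≤ T * increment ν a (oldest ε N) * slopeFactor 𝒞 ε T a N := by
      have h3 := hν.nondecreasing a (oldest ε N) (by simp [oldest])
        (by have := oldest_lt hε hε' hwin; have := pulls_before_le H s a; omega)
      have h4 := slopeFactor_nonneg (𝒞 := 𝒞) (ε := ε) (T := T) a N
      positivity
    have hcb : costBound ν 𝒞 σ ε α T a N
        = min 1 (2 * (σ * T * Real.sqrt (10 * (α * Real.log T) / (w : ℝ) ^ 3)))
          + min 1 (T * increment ν a (oldest ε N) * slopeFactor 𝒞 ε T a N) := by
      rw [costBound, if_neg hwin]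
    have hmin : (⨆ i, mean ν i (s + 1)) - mean ν a (triggers G H s a)
        ≤ costBound ν 𝒞 σ ε α T a N := by
      rw [hcb]
      refine le_trans (le_min hone ?_) (min_one_add_le (by positivity) hbias0)
      rw [← hj]
      have hj' : (fun i => mean ν i (↑s + 1)) j = mean ν j (s + 1) := rfl
      linarith
    linarith

theorem measurable_reward (s : Fin T) :
    Measurable fun H : History k T => mean ν (H s).1 (triggers G H s (H s).1) :=
  measurable_of_arms fun a => mean ν (a s) (∑ τ ∈ Finset.Iic s, G (a τ) (a s))

theorem integrable_reward [∀ i n, IsProbabilityMeasure (ν i n)] (hν : IsRising ν T σ)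
    (hG : IsBlockDiagonal G 𝒞) (π : Policy k) (s : Fin T) :
    Integrable (fun H : History k T => mean ν (H s).1 (triggers G H s (H s).1))
      (historyLaw ν G π T) := by
  refine Integrable.of_bound (measurable_reward s).aestronglyMeasurable 1 (ae_of_all _ fun H => ?_)
  have := reward_mem_Icc hν hG H s
  rw [Real.norm_eq_abs, abs_of_nonneg this.1]
  exact this.2

theorem expectedReward_le [∀ i n, IsProbabilityMeasure (ν i n)] (hν : IsRising ν T σ)
    (hG : IsBlockDiagonal G 𝒞) (π : Policy k) :
    expectedReward ν G T π ≤ ∑ s : Fin T, ⨆ i, mean ν i (s + 1) := by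
  unfold expectedReward
  refine (integral_mono (integrable_finsetSum _ fun s _ => integrable_reward hν hG π s)
    (integrable_const _) fun H => Finset.sum_le_sum fun s _ => reward_le hν hG H s).trans ?_
  simp

/-- The expected number of deviations is at most `2k` times a convergent series. -/
theorem sum_measure_deviation_le [∀ i n, IsProbabilityMeasure (ν i n)] (hν : IsRising ν T σ)
    (hG : IsBlockDiagonal G 𝒞) (π : Policy k) (hε : 0 < ε) (hε' : ε < 1 / 2) (hα : 2 < α) :
    ∑ s : Fin T, ∑ i : Fin k, ∑ N ∈ Finset.range (s + 1), (historyLaw ν G π T).real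
        (deviation ν G σ ε (fun t => (t : ℝ) ^ (-α)) s i N)
      ≤ 2 * (∑' n : ℕ, ((n + 1 : ℕ) : ℝ) ^ (1 - α)) * k := by
  have hs : Summable fun n : ℕ => ((n + 1 : ℕ) : ℝ) ^ (1 - α) :=
    (summable_nat_add_iff (f := fun n : ℕ => (n : ℝ) ^ (1 - α)) 1).2
      (Real.summable_nat_rpow.2 (by linarith))
  have hround : ∀ s : Fin T, ∑ i : Fin k, ∑ N ∈ Finset.range (s + 1), (historyLaw ν G π T).real
        (deviation ν G σ ε (fun t => (t : ℝ) ^ (-α)) s i N)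
      ≤ 2 * k * ((s + 1 : ℕ) : ℝ) ^ (1 - α) := by
    intro s
    have hs1 : (0 : ℝ) < ((s + 1 : ℕ) : ℝ) := by positivity
    have h1 : (1 : ℝ) ≤ ((s + 1 : ℕ) : ℝ) := by exact_mod_cast Nat.le_add_left 1 s
    calc _ ≤ ∑ i : Fin k, ∑ N ∈ Finset.range ((s : ℕ) + 1), 2 * ((s + 1 : ℕ) : ℝ) ^ (-α) := by
          refine Finset.sum_le_sum fun i _ => Finset.sum_le_sum fun N hN => ?_
          exact measure_deviation_le hν hG π hε hε' (δ := fun t => (t : ℝ) ^ (-α)) s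
            (by positivity) (Real.rpow_le_one_of_one_le_of_nonpos h1 (by linarith)) i
            (Nat.lt_succ_iff.1 (Finset.mem_range.1 hN))
      _ = 2 * k * (((s + 1 : ℕ) : ℝ) * ((s + 1 : ℕ) : ℝ) ^ (-α)) := by
          simp only [Finset.sum_const, Finset.card_univ, Fintype.card_fin, Finset.card_range,
            nsmul_eq_mul]
          ring
      _ = _ := by
          rw [sub_eq_add_neg, Real.rpow_add hs1, Real.rpow_one]
  refine (Finset.sum_le_sum fun s _ => hround s).trans ?_
  rw [← Finset.mul_sum,
    Fin.sum_univ_eq_sum_range (fun n : ℕ => ((n + 1 : ℕ) : ℝ) ^ (1 - α)) T]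
  have := hs.sum_le_tsum (Finset.range T) fun n _ => by positivity
  calc _ ≤ 2 * (k : ℝ) * ∑' n : ℕ, ((n + 1 : ℕ) : ℝ) ^ (1 - α) := by gcongr
    _ = _ := by ring

theorem Policy.nonempty_fin (π : Policy k) : Nonempty (Fin k) := by
  by_contra h
  rw [not_nonempty_iff] at h
  have h1 : π.next 0 Fin.elim0 Set.univ = 1 := measure_univ
  rw [Set.univ_eq_empty_iff.2 h, measure_empty] at h1
  exact zero_ne_one h1

/-- The regret is at most the deterministic total cost of the pulls plus the expected number of
deviations. -/
theorem regret_le [∀ i n, IsProbabilityMeasure (ν i n)] (hν : IsRising ν T σ)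
    (hG : IsBlockDiagonal G 𝒞) (hπ : IsRBoxUCB σ ε (fun t => (t : ℝ) ^ (-α)) π) (hε : 0 < ε)
    (hε' : ε < 1 / 2) (hα : 2 < α) {B : ℝ}
    (hB : ∀ N : Fin k → ℕ, ∑ i, N i ≤ T →
      ∑ i, ∑ n ∈ Finset.range (N i), costBound ν 𝒞 σ ε α T i n ≤ B) :
    regret ν G T π ≤ B + 2 * (∑' n : ℕ, ((n + 1 : ℕ) : ℝ) ^ (1 - α)) * k := by
  have hk := π.nonempty_fin
  have : Nonempty (Policy k) := ⟨π⟩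
  set P := historyLaw ν G π T with hP
  set δ : ℕ → ℝ := fun t => (t : ℝ) ^ (-α) with hδ
  have hsup : ⨆ π' : Policy k, expectedReward ν G T π' ≤ ∑ s : Fin T, ⨆ i, mean ν i (s + 1) :=
    ciSup_le fun π' => expectedReward_le hν hG π'
  have hindint : ∀ (s : Fin T) i N, Integrable
      ((deviation ν G σ ε δ s i N).indicator (1 : History k T → ℝ)) P :=
    fun s i N => (integrable_const (1 : ℝ)).indicator (measurableSet_deviation δ s i N)
  have hae : ∀ᵐ H ∂P, ∑ s : Fin T, ⨆ i, mean ν i (s + 1) ≤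
      ∑ s : Fin T, mean ν (H s).1 (triggers G H s (H s).1) + (B + ∑ s : Fin T, ∑ i,
        ∑ N ∈ Finset.range (s + 1), (deviation ν G σ ε δ s i N).indicator 1 H) := by
    filter_upwards [ae_next_ne_zero (G := G) π T] with H hH
    have h1 : ∑ s : Fin T, ((⨆ i, mean ν i (s + 1)) - mean ν (H s).1 (triggers G H s (H s).1))
        ≤ ∑ s : Fin T, (costBound ν 𝒞 σ ε α T (H s).1 (pulls (before H s) (H s).1)
          + ∑ i, ∑ N ∈ Finset.range (s + 1),
            (deviation ν G σ ε δ s i N).indicator 1 H) :=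
      Finset.sum_le_sum fun s _ =>
        loss_le hν hG hε hε' (by linarith) H s (hπ s (before H s) (H s).1 (hH s))
    rw [Finset.sum_sub_distrib, Finset.sum_add_distrib,
      sum_pulls_before H (costBound ν 𝒞 σ ε α T)] at h1
    have h2 := hB (pulls H) (sum_pulls H).le
    linarith
  have hRint : Integrable (fun H : History k T =>
      ∑ s : Fin T, mean ν (H s).1 (triggers G H s (H s).1)) P :=
    integrable_finsetSum _ fun s _ => integrable_reward hν hG π s
  have hDint : Integrable (fun H : History k T => ∑ s : Fin T, ∑ i,
      ∑ N ∈ Finset.range (s + 1), (deviation ν G σ ε δ s i N).indicator (1 : History k T → ℝ) H)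
      P :=
    integrable_finsetSum _ fun s _ => integrable_finsetSum _ fun i _ =>
      integrable_finsetSum _ fun N _ => hindint s i N
  have hBDint := (integrable_const (μ := P) B).add hDint
  have hint := integral_mono_ae (integrable_const _) (hRint.add hBDint) hae
  rw [integral_add' hRint hBDint, integral_add' (integrable_const _) hDint] at hint
  simp only [integral_const, probReal_univ, one_smul] at hint
  have hdev : ∫ H, (∑ s : Fin T, ∑ i, ∑ N ∈ Finset.range (s + 1),
      (deviation ν G σ ε δ s i N).indicator (1 : History k T → ℝ) H) ∂P
      = ∑ s : Fin T, ∑ i, ∑ N ∈ Finset.range (s + 1), P.real (deviation ν G σ ε δ s i N) := by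
    rw [integral_finsetSum _ fun s _ => integrable_finsetSum _ fun i _ =>
      integrable_finsetSum _ fun N _ => hindint s i N]
    refine Finset.sum_congr rfl fun s _ => ?_
    rw [integral_finsetSum _ fun i _ => integrable_finsetSum _ fun N _ => hindint s i N]
    refine Finset.sum_congr rfl fun i _ => ?_
    rw [integral_finsetSum _ fun N _ => hindint s i N]
    exact Finset.sum_congr rfl fun N _ =>
      integral_indicator_one (measurableSet_deviation δ s i N)
  rw [hdev] at hint
  have hsumdev := sum_measure_deviation_le hν hG π hε hε' hα
  unfold regret
  have hJ : expectedReward ν G T π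
      = ∫ H, (∑ s : Fin T, mean ν (H s).1 (triggers G H s (H s).1)) ∂P := rfl
  linarith

end Regret

end GTB

theorem theorem3p5 :
    ∃ p : ℕ, ∀ ε : ℝ, 0 < ε → ε < 1 / 2 → ∀ α : ℝ, 2 < α → ∃ K : ℝ,
      ∀ (k : ℕ) (σ : ℝ≥0) (π : GTB.Policy k),
        GTB.IsRBoxUCB σ ε (fun t => (t : ℝ) ^ (-α)) π →
        ∀ (T : ℕ) (ν : Fin k → ℕ → Measure ℝ) [∀ i n, IsProbabilityMeasure (ν i n)]
          (G : Matrix (Fin k) (Fin k) ℕ) (𝒞 : Finpartition (Finset.univ : Finset (Fin k))),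
          GTB.IsRising ν T σ → GTB.IsBlockDiagonal G 𝒞 →
          GTB.regret ν G T π ≤
            K * (1 + Real.log T) ^ p *
              ⨅ q : Set.Icc (0 : ℝ) 1,
                ((k : ℝ) + (k : ℝ) * ((σ : ℝ) * T) ^ (2 / 3 : ℝ) + GTB.biasTerm ν 𝒞 T q) := by
  refine ⟨2, fun ε hε hε' α hα => ⟨(3 + 1 / ε + 4 / ε * (1 + 10 * α) +
    6 / ε * ⌈1 / (1 - 2 * ε)⌉₊) + 2 * ∑' n : ℕ, ((n + 1 : ℕ) : ℝ) ^ (1 - α), ?_⟩⟩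
  intro k σ π hπ T ν _ G 𝒞 hν hG
  set K₁ := 3 + 1 / ε + 4 / ε * (1 + 10 * α) + 6 / ε * ⌈1 / (1 - 2 * ε)⌉₊ with hK₁
  set Z := ∑' n : ℕ, ((n + 1 : ℕ) : ℝ) ^ (1 - α) with hZ
  have hK₁0 : 0 ≤ K₁ := by positivity
  have hZ0 : 0 ≤ Z := tsum_nonneg fun n => by positivity
  have hlog2 : 1 ≤ (1 + Real.log T) ^ 2 :=
    one_le_pow₀ (by linarith [Real.log_natCast_nonneg T])
  rw [Real.mul_iInf_of_nonneg (by positivity)]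
  refine le_ciInf fun q => ?_
  have hreg := GTB.regret_le hν hG hπ hε hε' hα (fun N hN =>
    GTB.sum_costBound_le 𝒞 ε α hν hε hε' (by linarith) q.2.1 q.2.2 N hN)
  refine hreg.trans ?_
  have hB := GTB.biasTerm_nonneg 𝒞 hν (q : ℝ)
  have hy : 0 ≤ (k : ℝ) * ((σ : ℝ) * T) ^ (2 / 3 : ℝ) := by positivity
  have hk : (0 : ℝ) ≤ k := by positivity
  set X := (k : ℝ) + (k : ℝ) * ((σ : ℝ) * T) ^ (2 / 3 : ℝ) + GTB.biasTerm ν 𝒞 T q with hX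
  have hkX : (k : ℝ) ≤ (1 + Real.log T) ^ 2 * X := by
    have h1 : (k : ℝ) ≤ X := by linarith
    nlinarith
  have := mul_le_mul_of_nonneg_left hkX (by positivity : 0 ≤ 2 * Z)
  linarith
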